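/- **Theorem 3.6.** A group is *minimal non-abelian* if it is non-abelian and all its proper subgroups are abelian; an $\mathcal{A}_1$-group is a minimal non-abelian $p$-group. For a finite non-abelian $p$-group $G$ let $p^{I_{\max}}$ denote the maximal index in $G$ of an $\mathcal{A}_1$-subgroup of $G$. Write $[x,y]=x^{-1}y^{-1}xy$. Let $p$ be a prime and let $G$ be a group isomorphic to one of the following groups (all of which are finite non-abelian $p$-groups), each generated by $a,b,c$ subject to $[a,b]=c$ and the further relations shown; $n,m$ are integers and $t\in F_p^*$ (the multiplicative group of the field with $p$ elements). Types A ($p=2$): * (A1) $a^4=b^2=c^4=1,\ [c,a]=[c,b]=c^2$; * (A2) $a^4=b^4=1,\ c^2=a^2,\ [c,a]=[c,b]=c^2$; * (A3) $a^8=b^2=1,\ c^2=a^4,\ [c,a]=[c,b]=c^2$. Types B ($p=2$, $n\ge 3$): * (B1) $a^{2^{n+1}}=b^2=1,\ c^2=a^{2^n},\ [c,a]=1,\ [c,b]=c^2$; * (B2) $a^{2^n}=b^2=c^4=1,\ [c,a]=1,\ [c,b]=c^2$; * (B3) $a^{2^n}=b^4=1,\ c^2=b^2,\ [c,a]=1,\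 [c,b]=c^2$. Types C ($p=2$): * (C1) $a^8=1,\ c^2=a^4=b^4,\ [c,a]=[c,b]=1$; * (C2) $a^8=b^4=1,\ c^2=a^4,\ [c,a]=[c,b]=1$; * (C3) $a^8=1,\ c^2=a^4=b^4,\ [c,a]=1,\ [c,b]=c^2$; * (C4) $a^8=b^4=1,\ c^2=a^4,\ [c,a]=1,\ [c,b]=c^2$; * (C5) $a^8=b^4=1,\ c^2=a^4,\ [c,a]=c^2,\ [c,b]=1$. Types D ($n\ge 2$, and $n\ge 3$ if $p=2$): * (D1) $a^{p^{n+1}}=b^{p^n}=1,\ c^p=a^{p^n},\ [c,a]=1,\ [c,b]=c^{tp}$; * (D2) $a^{p^{n+1}}=b^{p^n}=1,\ c^p=a^{p^n},\ [c,a]=c^p,\ [c,b]=1$; * (D3) $a^{p^{n+1}}=b^{p^n}=1,\ c^p=a^{p^n},\ [c,a]=[c,b]=1$; * (D4) $a^{p^n}=b^{p^n}=c^{p^2}=1,\ [c,a]=c^p,\ [c,b]=1$; * (D5) $a^{p^n}=b^{p^n}=c^{p^2}=1,\ [c,a]=[c,b]=1$. Types E ($n>m\ge 2$): * (E1) $a^{p^{n+1}}=b^{p^m}=1,\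 c^p=a^{p^n},\ [c,a]=1,\ [c,b]=c^{tp}$; * (E2) $a^{p^{n+1}}=b^{p^m}=1,\ c^p=a^{p^n},\ [c,a]=c^p,\ [c,b]=1$; * (E3) $a^{p^{n+1}}=b^{p^m}=1,\ c^p=a^{p^n},\ [c,a]=[c,b]=1$; * (E4) $a^{p^n}=b^{p^{m+1}}=1,\ c^p=b^{p^m},\ [c,a]=1,\ [c,b]=c^p$; * (E5) $a^{p^n}=b^{p^{m+1}}=1,\ c^p=b^{p^m},\ [c,a]=c^{tp},\ [c,b]=1$; * (E6) $a^{p^n}=b^{p^{m+1}}=1,\ c^p=b^{p^m},\ [c,a]=[c,b]=1$; * (E7) $a^{p^n}=b^{p^m}=c^{p^2}=1,\ [c,a]=1,\ [c,b]=c^p$; * (E8) $a^{p^n}=b^{p^m}=c^{p^2}=1,\ [c,a]=c^p,\ [c,b]=1$; * (E9) $a^{p^n}=b^{p^m}=c^{p^2}=1,\ [c,a]=[c,b]=1$. Then: 1. $I_{\max}=2$ for types (A1)–(A3), (C1)–(C5), (D3), (D5), (E3), (E6), (E9); 2. $I_{\max}=n$ for types (B1)–(B3), (D1), (D2), (D4),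 (E1), (E4), (E7); 3. $I_{\max}=m$ for types (E2), (E5), (E8). -/

import Mathlib

/-- A minimal non-abelian group: it is non-abelian and all its proper subgroups are abelian.
An `𝒜₁`-group is a minimal non-abelian `p`-group. -/
def IsMinimalNonabelian (G : Type*) [Group G] : Prop :=
  (∃ x y : G, x * y ≠ y * x) ∧
    ∀ K : Subgroup G, K ≠ ⊤ → ∀ x ∈ K, ∀ y ∈ K, x * y = y * x

/-- `G` is a finite `p`-group and `I_max(G) = k`: the maximal index of the `𝒜₁`-subgroups of `G`
is `p ^ k`. (Every subgroup of a `p`-group is a `p`-group, so the `𝒜₁`-subgroups are the minimal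
non-abelian subgroups.) -/
def HasIMax (p : ℕ) (G : Type*) [Group G] (k : ℕ) : Prop :=
  Finite G ∧ IsPGroup p G ∧
    IsGreatest {i : ℕ | ∃ H : Subgroup G, IsMinimalNonabelian H ∧ H.index = i} (p ^ k)

/-- The names of the types of groups in the list. -/
inductive GroupLabel : Type
  | A1 | A2 | A3
  | B1 | B2 | B3
  | C1 | C2 | C3 | C4 | C5
  | D1 | D2 | D3 | D4 | D5
  | E1 | E2 | E3 | E4 | E5 | E6 | E7 | E8 | E9

namespace GroupLabel

/-- The restrictions on the prime `p` and on the parameters `n`, `m` for each type. Here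
`(n, m) = (2, 1)` for the types A, `m = 1` for the types B, `(n, m) = (2, 2)` for the types C
and `m = n` for the types D. -/
def Admissible (p n m : ℕ) : GroupLabel → Prop
  | A1 | A2 | A3 => p = 2 ∧ n = 2 ∧ m = 1
  | B1 | B2 | B3 => p = 2 ∧ 3 ≤ n ∧ m = 1
  | C1 | C2 | C3 | C4 | C5 => p = 2 ∧ n = 2 ∧ m = 2
  | D1 | D2 | D3 | D4 | D5 => 2 ≤ n ∧ (p = 2 → 3 ≤ n) ∧ m = n
  | E1 | E2 | E3 | E4 | E5 | E6 | E7 | E8 | E9 => m < n ∧ 2 ≤ m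

/-- The commutator `[x, y] = x⁻¹ y⁻¹ x y`. -/
def comm {G : Type*} [Group G] (x y : G) : G := x⁻¹ * y⁻¹ * x * y

/-- The defining relations `u = v`, listed as pairs `(u, v)`, of the group of each type, as a
function of three elements `a`, `b`, `c` of a group. The natural number `t` occurs only in the
types D1, E1 and E5. -/
def relations {F : Type*} [Group F] (p n m t : ℕ) (a b c : F) : GroupLabel → List (F × F)
  | A1 => [(a ^ 4, 1), (b ^ 2, 1), (c ^ 4, 1),
      (comm a b, c), (comm c a, c ^ 2), (comm c b, c ^ 2)]
  | A2 => [(a ^ 4, 1), (b ^ 4, 1), (c ^ 2, a ^ 2),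
      (comm a b, c), (comm c a, c ^ 2), (comm c b, c ^ 2)]
  | A3 => [(a ^ 8, 1), (b ^ 2, 1), (c ^ 2, a ^ 4),
      (comm a b, c), (comm c a, c ^ 2), (comm c b, c ^ 2)]
  | B1 => [(a ^ 2 ^ (n + 1), 1), (b ^ 2, 1), (c ^ 2, a ^ 2 ^ n),
      (comm a b, c), (comm c a, 1), (comm c b, c ^ 2)]
  | B2 => [(a ^ 2 ^ n, 1), (b ^ 2, 1), (c ^ 4, 1),
      (comm a b, c), (comm c a, 1), (comm c b, c ^ 2)]
  | B3 => [(a ^ 2 ^ n, 1), (b ^ 4, 1), (c ^ 2, b ^ 2),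
      (comm a b, c), (comm c a, 1), (comm c b, c ^ 2)]
  | C1 => [(a ^ 8, 1), (c ^ 2, a ^ 4), (a ^ 4, b ^ 4),
      (comm a b, c), (comm c a, 1), (comm c b, 1)]
  | C2 => [(a ^ 8, 1), (b ^ 4, 1), (c ^ 2, a ^ 4),
      (comm a b, c), (comm c a, 1), (comm c b, 1)]
  | C3 => [(a ^ 8, 1), (c ^ 2, a ^ 4), (a ^ 4, b ^ 4),
      (comm a b, c), (comm c a, 1), (comm c b, c ^ 2)]
  | C4 => [(a ^ 8, 1), (b ^ 4, 1), (c ^ 2, a ^ 4),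
      (comm a b, c), (comm c a, 1), (comm c b, c ^ 2)]
  | C5 => [(a ^ 8, 1), (b ^ 4, 1), (c ^ 2, a ^ 4),
      (comm a b, c), (comm c a, c ^ 2), (comm c b, 1)]
  | D1 => [(a ^ p ^ (n + 1), 1), (b ^ p ^ n, 1), (c ^ p, a ^ p ^ n),
      (comm a b, c), (comm c a, 1), (comm c b, c ^ (t * p))]
  | D2 => [(a ^ p ^ (n + 1), 1), (b ^ p ^ n, 1), (c ^ p, a ^ p ^ n),
      (comm a b, c), (comm c a, c ^ p), (comm c b, 1)]
  | D3 => [(a ^ p ^ (n + 1), 1), (b ^ p ^ n, 1), (c ^ p, a ^ p ^ n),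
      (comm a b, c), (comm c a, 1), (comm c b, 1)]
  | D4 => [(a ^ p ^ n, 1), (b ^ p ^ n, 1), (c ^ p ^ 2, 1),
      (comm a b, c), (comm c a, c ^ p), (comm c b, 1)]
  | D5 => [(a ^ p ^ n, 1), (b ^ p ^ n, 1), (c ^ p ^ 2, 1),
      (comm a b, c), (comm c a, 1), (comm c b, 1)]
  | E1 => [(a ^ p ^ (n + 1), 1), (b ^ p ^ m, 1), (c ^ p, a ^ p ^ n),
      (comm a b, c), (comm c a, 1), (comm c b, c ^ (t * p))]
  | E2 => [(a ^ p ^ (n + 1), 1), (b ^ p ^ m, 1), (c ^ p, a ^ p ^ n),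
      (comm a b, c), (comm c a, c ^ p), (comm c b, 1)]
  | E3 => [(a ^ p ^ (n + 1), 1), (b ^ p ^ m, 1), (c ^ p, a ^ p ^ n),
      (comm a b, c), (comm c a, 1), (comm c b, 1)]
  | E4 => [(a ^ p ^ n, 1), (b ^ p ^ (m + 1), 1), (c ^ p, b ^ p ^ m),
      (comm a b, c), (comm c a, 1), (comm c b, c ^ p)]
  | E5 => [(a ^ p ^ n, 1), (b ^ p ^ (m + 1), 1), (c ^ p, b ^ p ^ m),
      (comm a b, c), (comm c a, c ^ (t * p)), (comm c b, 1)]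
  | E6 => [(a ^ p ^ n, 1), (b ^ p ^ (m + 1), 1), (c ^ p, b ^ p ^ m),
      (comm a b, c), (comm c a, 1), (comm c b, 1)]
  | E7 => [(a ^ p ^ n, 1), (b ^ p ^ m, 1), (c ^ p ^ 2, 1),
      (comm a b, c), (comm c a, 1), (comm c b, c ^ p)]
  | E8 => [(a ^ p ^ n, 1), (b ^ p ^ m, 1), (c ^ p ^ 2, 1),
      (comm a b, c), (comm c a, c ^ p), (comm c b, 1)]
  | E9 => [(a ^ p ^ n, 1), (b ^ p ^ m, 1), (c ^ p ^ 2, 1),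
      (comm a b, c), (comm c a, 1), (comm c b, 1)]

/-- The relators `u v⁻¹` for the relations `u = v`, in the free group on three generators. -/
def relators (p n m t : ℕ) (L : GroupLabel) : Set (FreeGroup (Fin 3)) :=
  {r | ∃ q ∈ L.relations p n m t (FreeGroup.of 0) (FreeGroup.of 1) (FreeGroup.of 2),
    r = q.1 * q.2⁻¹}

/-- The group `⟨a, b, c ∣ relations⟩` of the given type, with parameters `p`, `n`, `m` and
`t ∈ F_p^*`. The unit `t` is represented by its least non-negative residue; `t` occurs only as
an exponent of `c ^ p`, and `(c ^ p) ^ p = 1` follows from the relations. -/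
abbrev Model (p n m : ℕ) (t : (ZMod p)ˣ) (L : GroupLabel) : Type :=
  PresentedGroup (L.relators p n m (t : ZMod p).val)

end GroupLabel

/-! All the types share one shape: `⟨c⟩` is normal of order `p ^ 2`, `G` acts on it trivially modulo
`⟨c ^ p⟩`, and `G / ⟨c⟩` is a product of cyclic groups of orders `p ^ N` and `p ^ M` generated by
the images of `a` and `b`. Hence `|G| = p ^ (N + M + 2)`, `c ^ p` is central, commutators are powers
of `c`, `p`-th powers commute with `c` and with each other, and `p ^ 2`-th powers are central. Since
every nonabelian subgroup contains a minimal nonabelian one, `I_max` is found by bounding the orders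
of nonabelian subgroups `H` from below. Such an `H` has an element generating one of the two cyclic
quotients, because otherwise it would consist of products `y ^ p * c ^ k`, which commute.

If `c` is central, then `|H| ≥ p ^ (N + M)` (`le_card_of_commute`), and `⟨a ^ p, b, c ^ p⟩` shows
that `I_max = 2`.

If `[c, b] ≠ 1`, then `ker f = ⟨b, c⟩` is nonabelian of index `p ^ N`. It has the least order `p ^
(M + 2)`: for `H` centralizing `c` the previous bound suffices as `N ≥ 2`, and otherwise an element
of `H` moving `c` generates a quotient, so `le_card_of_not_commute` applies. The condition that `[c,
a] = 1` or `M ≤ N` excludes a smaller `H` mapping onto the first quotient. The case `[c, a] ≠ 1` is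
symmetric.

It remains to see that the presentations really give this shape. Generators and relations yield the
upper bounds on orders; that `c` has order exactly `p ^ 2` follows from an explicit quotient of
`ClassThreeGroup` (`exists_pow_ne_one`). -/

/-- `G` is an extension of the direct product of two cyclic groups of orders `p ^ N` and `p ^ M`,
generated by the images of `a` and `b`, by the cyclic subgroup `⟨c⟩` of order `p ^ 2`, on which
`G` acts trivially modulo `⟨c ^ p⟩`. -/
structure IsBicyclicExtension (p N M : ℕ) {G A B : Type*} [Group G] [Group A] [Group B]
    (a b c : G) (f : G →* A) (g : G →* B) : Prop where
  mem_zpowers_left : ∀ x : A, x ∈ Subgroup.zpowers (f a)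
  mem_zpowers_right : ∀ x : B, x ∈ Subgroup.zpowers (g b)
  orderOf_left : orderOf (f a) = p ^ N
  orderOf_right : orderOf (g b) = p ^ M
  left_b : f b = 1
  right_a : g a = 1
  left_c : f c = 1
  right_c : g c = 1
  mem_ker : ∀ x, f x = 1 → g x = 1 → x ∈ Subgroup.zpowers c
  orderOf_c : orderOf c = p ^ 2
  conj : ∀ x, ∃ w : ℤ, c * x = x * c ^ (1 + p * w)
  pow_left : a ^ p ^ N ∈ Subgroup.zpowers (c ^ p)
  pow_right : b ^ p ^ M ∈ Subgroup.zpowers (c ^ p)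

/-- A subgroup all of whose elements are products `x ^ r * k` with `k ∈ K` is abelian if the
elements of `K` commute with `x` and with each other. -/
theorem commute_of_forall_zpow_mul {G : Type*} [Group G] {H : Subgroup G} {x : G}
    {K : Set G} (hHK : ∀ h ∈ H, ∃ r : ℤ, ∃ k ∈ K, h = x ^ r * k)
    (hx : ∀ k ∈ K, Commute x k) (hK : ∀ k ∈ K, ∀ l ∈ K, Commute k l) :
    ∀ u ∈ H, ∀ v ∈ H, u * v = v * u := by
  intro u hu v hv
  obtain ⟨r, k, hk, rfl⟩ := hHK u hu
  obtain ⟨s, l, hl, rfl⟩ := hHK v hv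
  have h1 : Commute (x ^ r) (x ^ s) := (Commute.refl x).zpow_zpow r s
  have h2 : Commute (x ^ r) l := (hx l hl).zpow_left r
  have h3 : Commute k (x ^ s) := ((hx k hk).zpow_left s).symm
  exact ((h1.mul_right h2).mul_left (h3.mul_right (hK k hk l hl)))

/-! ### Commutators and powers in a bicyclic extension. -/

namespace IsBicyclicExtension

variable {p N M : ℕ} {G A B : Type*} [Group G] [Group A] [Group B]
  {a b c : G} {f : G →* A} {g : G →* B}

/-- The relation `[a, b] = c` is not part of the structure, so `a` and `b` play interchangeable
roles. -/
theorem symm (h : IsBicyclicExtension p N M a b c f g) : IsBicyclicExtension p M N b a c g f :=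
  ⟨h.2, h.1, h.4, h.3, h.6, h.5, h.8, h.7, fun x h1 h2 => h.mem_ker x h2 h1, h.orderOf_c, h.conj,
    h.pow_right, h.pow_left⟩

theorem c_pow (h : IsBicyclicExtension p N M a b c f g) : c ^ ((p : ℤ) * p) = 1 := by
  have := pow_orderOf_eq_one c
  rw [h.orderOf_c] at this
  rw [← this, ← zpow_natCast]; push_cast; rw [sq]

theorem c_zpow_mul (h : IsBicyclicExtension p N M a b c f g) (k : ℤ) :
    c ^ ((p : ℤ) * p * k) = 1 := by
  rw [zpow_mul, h.c_pow, one_zpow]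

theorem c_zpow_eq_one (h : IsBicyclicExtension p N M a b c f g) (k : ℤ) :
    c ^ k = 1 ↔ (p : ℤ) ^ 2 ∣ k := by
  rw [← orderOf_dvd_iff_zpow_eq_one, h.orderOf_c]; push_cast; rfl

theorem exists_c_zpow_mul_eq (h : IsBicyclicExtension p N M a b c f g) (x : G) :
    ∃ w : ℤ, ∀ k : ℤ, c ^ k * x = x * c ^ (k * (1 + p * w)) := by
  obtain ⟨w, hw⟩ := h.conj x
  refine ⟨w, fun k => ?_⟩
  have : c ^ k = x * (c ^ (1 + p * w)) ^ k * x⁻¹ := by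
    rw [← conj_zpow]; congr 1; rw [← hw]; group
  rw [this, ← zpow_mul, mul_comm k]; group

theorem commute_zpow_p (h : IsBicyclicExtension p N M a b c f g) (k : ℤ) (x : G) :
    Commute (c ^ ((p : ℤ) * k)) x := by
  obtain ⟨w, hw⟩ := h.exists_c_zpow_mul_eq x
  rw [commute_iff_eq, hw, show (p : ℤ) * k * (1 + p * w) = p * k + p * p * (k * w) by ring,
    zpow_add, h.c_zpow_mul, mul_one]

theorem exists_comm (h : IsBicyclicExtension p N M a b c f g) (x y : G) :
    ∃ r : ℤ, x * y = y * x * c ^ r := by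
  have hA : ∀ u v : A, u * v = v * u := by
    intro u v
    obtain ⟨i, rfl⟩ := h.mem_zpowers_left u
    obtain ⟨j, rfl⟩ := h.mem_zpowers_left v
    exact (Commute.refl (f a)).zpow_zpow i j
  have hB : ∀ u v : B, u * v = v * u := by
    intro u v
    obtain ⟨i, rfl⟩ := h.mem_zpowers_right u
    obtain ⟨j, rfl⟩ := h.mem_zpowers_right v
    exact (Commute.refl (g b)).zpow_zpow i j
  obtain ⟨r, hr⟩ := h.mem_ker ((y * x)⁻¹ * (x * y))
    (by simp only [map_mul, map_inv]; rw [hA (f y)]; group)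
    (by simp only [map_mul, map_inv]; rw [hB (g y)]; group)
  exact ⟨r, by simp only at hr; rw [hr]; group⟩

theorem exists_comm_pow (h : IsBicyclicExtension p N M a b c f g) (x y : G) :
    ∃ s : ℤ, x * y ^ p = y ^ p * x * c ^ ((p : ℤ) * s) := by
  obtain ⟨r, hr⟩ := h.exists_comm x y
  obtain ⟨w, hw⟩ := h.exists_c_zpow_mul_eq y
  -- Each further factor `y` contributes `r` to the exponent, up to a multiple of `p`; so at `k = p`
  -- the whole exponent is divisible by `p`.
  have key : ∀ k : ℕ, ∃ s : ℤ, x * y ^ k = y ^ k * x * c ^ (r * k + p * s) := by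
    intro k
    induction k with
    | zero => exact ⟨0, by simp⟩
    | succ k ih =>
      obtain ⟨s, hs⟩ := ih
      refine ⟨r * k * w + s + p * s * w, ?_⟩
      rw [pow_succ, ← mul_assoc, hs, mul_assoc, hw, ← mul_assoc, mul_assoc (y ^ k), hr,
        ← mul_assoc, ← mul_assoc, mul_assoc _ (c ^ r), ← zpow_add]
      congr 2
      push_cast; ring
  obtain ⟨s, hs⟩ := key p
  exact ⟨r + s, by rw [hs]; congr 2; ring⟩

/-- Conjugation by `x` raises `c` to a power `1 + p * w`, and the `p`-th power of this multiplier is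
`1` modulo `p ^ 2`. -/
theorem commute_c_pow (h : IsBicyclicExtension p N M a b c f g) (x : G) : Commute c (x ^ p) := by
  obtain ⟨w, hw⟩ := h.conj x
  have key : ∀ k : ℕ, c * x ^ k = x ^ k * c ^ (1 + (p : ℤ) * (k * w)) := by
    intro k
    induction k with
    | zero => simp
    | succ k ih =>
      rw [pow_succ, ← mul_assoc, ih, zpow_add, zpow_one, mul_assoc, mul_assoc c,
        (h.commute_zpow_p _ x).eq, ← mul_assoc c, hw, zpow_add, zpow_one, mul_assoc x, mul_assoc c,
        ← zpow_add, mul_assoc, ← zpow_one_add]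
      congr 4
      push_cast; ring
  rw [commute_iff_eq, key, zpow_add, zpow_one, show (p : ℤ) * (p * w) = p * p * w by ring,
    h.c_zpow_mul, mul_one]

/-- The commutator of `x` with `y ^ p` is a power of the central element `c ^ p`, whose order
divides `p`, so passing to `x ^ p` kills it. Replacing `y ^ p` by its `p`-th power has the same
effect, which gives `commute_pow_sq`. -/
theorem commute_pow_pow (h : IsBicyclicExtension p N M a b c f g) (x y : G) :
    Commute (x ^ p) (y ^ p) := by
  obtain ⟨s, hs⟩ := h.exists_comm_pow x y
  have key : ∀ k : ℕ, x ^ k * y ^ p = y ^ p * x ^ k * c ^ ((p : ℤ) * (k * s)) := by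
    intro k
    induction k with
    | zero => simp
    | succ k ih =>
      rw [pow_succ', mul_assoc, ih, ← mul_assoc, ← mul_assoc, hs, mul_assoc _ _ (x ^ k),
        (h.commute_zpow_p _ _).eq, ← mul_assoc, mul_assoc _ (c ^ _), ← zpow_add, mul_assoc _ x]
      congr 2
      push_cast; ring
  rw [commute_iff_eq, key, show (p : ℤ) * (p * s) = p * p * s by ring, h.c_zpow_mul, mul_one]

theorem commute_pow_sq (h : IsBicyclicExtension p N M a b c f g) (x y : G) :
    Commute x (y ^ (p * p)) := by
  obtain ⟨s, hs⟩ := h.exists_comm_pow x y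
  have key : ∀ k : ℕ, x * (y ^ p) ^ k = (y ^ p) ^ k * x * c ^ ((p : ℤ) * (k * s)) := by
    intro k
    induction k with
    | zero => simp
    | succ k ih =>
      rw [pow_succ, ← mul_assoc, ih, mul_assoc, (h.commute_zpow_p _ _).eq, ← mul_assoc,
        mul_assoc _ x, hs, ← mul_assoc, ← mul_assoc, mul_assoc _ (c ^ _), ← zpow_add]
      congr 2
      push_cast; ring
  rw [commute_iff_eq, pow_mul, key, show (p : ℤ) * (p * s) = p * p * s by ring, h.c_zpow_mul,
    mul_one]

theorem exists_eq_mul_c_zpow (h : IsBicyclicExtension p N M a b c f g) {x y : G}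
    (hf : f x = f y) (hg : g x = g y) : ∃ k : ℤ, x = y * c ^ k := by
  obtain ⟨k, hk⟩ := h.mem_ker (y⁻¹ * x) (by simp [hf]) (by simp [hg])
  exact ⟨k, by simp only at hk; rw [hk]; group⟩

/-- Every element is a product of powers of `a`, `b` and `c`; the exponents of `a` and `b` are
those of its images. -/
theorem exists_zpow (h : IsBicyclicExtension p N M a b c f g) (x : G) :
    ∃ i j k : ℤ, f x = f a ^ i ∧ g x = g b ^ j ∧ x = a ^ i * b ^ j * c ^ k := by
  obtain ⟨i, hi⟩ := h.mem_zpowers_left (f x)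
  obtain ⟨j, hj⟩ := h.mem_zpowers_right (g x)
  obtain ⟨k, hk⟩ := h.exists_eq_mul_c_zpow (x := x) (y := a ^ i * b ^ j)
    (by simp [h.left_b, ← hi]) (by simp [h.right_a, ← hj])
  exact ⟨i, j, k, hi.symm, hj.symm, hk⟩

theorem commute_c_of_pow (h : IsBicyclicExtension p N M a b c f g) {x y : G} {k : ℤ}
    (hx : x = y ^ p * c ^ k) : Commute c x := by
  subst hx
  exact (h.commute_c_pow y).mul_right ((Commute.refl c).zpow_right k)

theorem card_left (h : IsBicyclicExtension p N M a b c f g) : Nat.card A = p ^ N := by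
  rw [← h.orderOf_left, orderOf_eq_card_of_forall_mem_zpowers h.mem_zpowers_left]

theorem range_left (h : IsBicyclicExtension p N M a b c f g) : f.range = ⊤ := by
  rw [eq_top_iff]
  rintro x -
  obtain ⟨i, rfl⟩ := h.mem_zpowers_left x
  exact ⟨a ^ i, by simp⟩

theorem index_ker_left (h : IsBicyclicExtension p N M a b c f g) : f.ker.index = p ^ N := by
  rw [Subgroup.index_ker, h.range_left, Subgroup.card_top, h.card_left]

theorem card_ker_left (h : IsBicyclicExtension p N M a b c f g) :
    Nat.card f.ker = p ^ (M + 2) := by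
  have h1 := (g.comp f.ker.subtype).ker.card_mul_index
  have hr : (g.comp f.ker.subtype).range = ⊤ := by
    rw [eq_top_iff]
    rintro x -
    obtain ⟨i, rfl⟩ := h.mem_zpowers_right x
    exact ⟨⟨b ^ i, by simp [MonoidHom.mem_ker, h.left_b]⟩, by simp⟩
  have hk : (g.comp f.ker.subtype).ker.map f.ker.subtype = Subgroup.zpowers c := by
    ext x
    simp only [Subgroup.mem_map, MonoidHom.mem_ker, MonoidHom.comp_apply, Subgroup.subtype_apply,
      Subtype.exists, exists_and_right, exists_eq_right]
    constructor
    · rintro ⟨hf, hg⟩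
      exact h.mem_ker x hf hg
    · rintro ⟨k, rfl⟩
      exact ⟨by simp [h.left_c], by simp [h.right_c]⟩
  rw [Subgroup.index_ker, hr, Subgroup.card_top, h.symm.card_left,
    ← Subgroup.card_map_of_injective f.ker.subtype_injective, hk, Nat.card_zpowers,
    h.orderOf_c] at h1
  rw [← h1]; ring

theorem card_eq (h : IsBicyclicExtension p N M a b c f g) :
    Nat.card G = p ^ (N + M + 2) := by
  rw [← f.ker.card_mul_index, h.card_ker_left, h.index_ker_left]; ring

end IsBicyclicExtension

/-! ### Lower bounds for the orders of nonabelian subgroups. -/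

/-- Two elements of `H` do not commute. -/
def Subgroup.IsNonabelian {G : Type*} [Group G] (H : Subgroup G) : Prop :=
  ∃ x ∈ H, ∃ y ∈ H, x * y ≠ y * x

namespace IsBicyclicExtension

variable {p N M : ℕ} {G A B : Type*} [Group G] [Group A] [Group B]
  {a b c : G} {f : G →* A} {g : G →* B}

theorem finite (h : IsBicyclicExtension p N M a b c f g) (hp : p.Prime) : Finite G :=
  Nat.finite_of_card_ne_zero (by rw [h.card_eq]; exact pow_ne_zero _ hp.ne_zero)

theorem exists_card_eq (h : IsBicyclicExtension p N M a b c f g) (hp : p.Prime)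
    (K : Subgroup G) : ∃ s, Nat.card K = p ^ s := by
  obtain ⟨s, -, hs⟩ := (Nat.dvd_prime_pow hp).1 (h.card_eq ▸ K.card_subgroup_dvd_card)
  exact ⟨s, hs⟩

theorem generates_left (h : IsBicyclicExtension p N M a b c f g) (hp : p.Prime) {x : G} {i : ℤ}
    (hx : f x = f a ^ i) (hi : ¬ (p : ℤ) ∣ i) (y : A) : y ∈ Subgroup.zpowers (f x) := by
  have hc : IsCoprime i ((p : ℤ) ^ N) :=
    (((Nat.prime_iff_prime_int.1 hp).coprime_iff_not_dvd.2 hi).symm).pow_right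
  obtain ⟨u, v, huv⟩ := hc
  have ha : f a = f x ^ u := by
    have h1 : f a ^ ((p : ℤ) ^ N) = 1 := by
      have := pow_orderOf_eq_one (f a)
      rw [h.orderOf_left, ← zpow_natCast] at this
      simpa using this
    have h2 : f a ^ (u * i + v * (p : ℤ) ^ N) = f a ^ (i * u) := by
      rw [zpow_add, mul_comm v, zpow_mul _ _ v, h1, one_zpow, mul_one, mul_comm]
    rw [huv, zpow_one, zpow_mul, ← hx] at h2
    exact h2
  obtain ⟨r, rfl⟩ := h.mem_zpowers_left y
  exact ⟨u * r, by simp only; rw [zpow_mul, ← ha]⟩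

theorem exists_eq_pow_mul_c_zpow (h : IsBicyclicExtension p N M a b c f g) {x : G} {i j : ℤ}
    (hf : f x = f a ^ (p * i)) (hg : g x = g b ^ (p * j)) :
    ∃ y : G, ∃ k : ℤ, x = y ^ p * c ^ k := by
  refine ⟨a ^ i * b ^ j, h.exists_eq_mul_c_zpow ?_ ?_⟩
  · simp [hf, h.left_b, zpow_mul', zpow_natCast]
  · simp [hg, h.right_a, zpow_mul', zpow_natCast]

theorem exists_not_dvd (h : IsBicyclicExtension p N M a b c f g) {H : Subgroup G}
    (hH : H.IsNonabelian) : ∃ x ∈ H, ∃ i j : ℤ, f x = f a ^ i ∧ g x = g b ^ j ∧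
      (¬ (p : ℤ) ∣ i ∨ ¬ (p : ℤ) ∣ j) := by
  by_contra! hcon
  have key : ∀ x ∈ H, ∃ y : G, ∃ k : ℤ, x = y ^ p * c ^ k := by
    intro x hx
    obtain ⟨i, j, -, hi, hj, -⟩ := h.exists_zpow x
    obtain ⟨⟨i, rfl⟩, ⟨j, rfl⟩⟩ := hcon x hx i j hi hj
    exact h.exists_eq_pow_mul_c_zpow hi hj
  obtain ⟨x, hx, y, hy, hxy⟩ := hH
  obtain ⟨u, k, hu⟩ := key x hx
  obtain ⟨v, l, hv⟩ := key y hy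
  apply hxy
  have h1 := h.commute_c_of_pow hv
  have h2 := h.commute_pow_pow u v
  have h3 := (h.commute_c_pow u).zpow_left l
  rw [hu]
  refine Commute.mul_left ?_ (h1.zpow_left k)
  rw [hv]
  exact h2.mul_right h3.symm

theorem exists_mem_zpowers_c (h : IsBicyclicExtension p N M a b c f g) {H : Subgroup G}
    (hH : H.IsNonabelian) : ∃ r : ℤ, c ^ r ∈ H ∧ c ^ r ≠ 1 := by
  obtain ⟨x, hx, y, hy, hxy⟩ := hH
  obtain ⟨r, hr⟩ := h.exists_comm x y
  refine ⟨r, ?_, fun h1 => hxy (by rw [hr, h1, mul_one])⟩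
  have : c ^ r = (y * x)⁻¹ * (x * y) := by rw [hr]; group
  rw [this]
  exact H.mul_mem (H.inv_mem (H.mul_mem hy hx)) (H.mul_mem hx hy)

theorem card_eq_mul (h : IsBicyclicExtension p N M a b c f g) {H : Subgroup G} {x : G}
    (hx : x ∈ H) (hgen : ∀ y : A, y ∈ Subgroup.zpowers (f x)) :
    Nat.card H = p ^ N * Nat.card (H ⊓ f.ker : Subgroup G) := by
  have h1 := (f.comp H.subtype).ker.card_mul_index
  have hr : (f.comp H.subtype).range = ⊤ := by
    rw [eq_top_iff]
    rintro y -
    obtain ⟨i, rfl⟩ := hgen y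
    exact ⟨⟨x ^ i, H.zpow_mem hx i⟩, by simp⟩
  have hk : (f.comp H.subtype).ker.map H.subtype = H ⊓ f.ker := by
    ext y
    simp only [Subgroup.mem_map, MonoidHom.mem_ker, MonoidHom.comp_apply, Subgroup.subtype_apply,
      Subtype.exists, exists_and_right, exists_eq_right, Subgroup.mem_inf]
    exact ⟨fun ⟨h1, h2⟩ => ⟨h1, h2⟩, fun ⟨h1, h2⟩ => ⟨h1, h2⟩⟩
  rw [Subgroup.index_ker, hr, Subgroup.card_top, h.card_left,
    ← Subgroup.card_map_of_injective H.subtype_injective, hk] at h1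
  rw [← h1, mul_comm]

theorem exists_zpow_mul {H : Subgroup G} {x : G}
    (hx : x ∈ H) (hgen : ∀ y : A, y ∈ Subgroup.zpowers (f x)) :
    ∀ u ∈ H, ∃ r : ℤ, ∃ k ∈ ((H ⊓ f.ker : Subgroup G) : Set G), u = x ^ r * k := by
  intro u hu
  obtain ⟨r, hr⟩ := hgen (f u)
  refine ⟨r, (x ^ r)⁻¹ * u, ⟨H.mul_mem (H.inv_mem (H.zpow_mem hx r)) hu, ?_⟩, by group⟩
  simp only at hr
  simp [hr]

/-- Here `H = ⟨x⟩ K` with `K = H ∩ ker f`. If `|K| < p ^ 2`, then `K` is generated by a nontrivial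
commutator of order `p` in `⟨c⟩`, which is central, so `H` would be abelian. -/
theorem le_card_of_not_commute (h : IsBicyclicExtension p N M a b c f g) (hp : p.Prime)
    {H : Subgroup G} (hH : H.IsNonabelian) {x : G} (hx : x ∈ H) {i : ℤ}
    (hf : f x = f a ^ i) (hi : ¬ (p : ℤ) ∣ i) : p ^ (N + 2) ≤ Nat.card H := by
  have hfin := h.finite hp
  have hgen := h.generates_left hp hf hi
  set K : Subgroup G := H ⊓ f.ker with hK
  rw [h.card_eq_mul hx hgen, pow_add]
  refine Nat.mul_le_mul_left _ ?_
  obtain ⟨s, hs⟩ := h.exists_card_eq hp K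
  rw [← hK, hs]
  refine Nat.pow_le_pow_right hp.pos ?_
  by_contra! hlt
  obtain ⟨r, hr, hr1⟩ := h.exists_mem_zpowers_c hH
  have hrK : c ^ r ∈ K := ⟨hr, by simp [h.left_c]⟩
  have hcard : Nat.card K = p := by
    interval_cases s
    · rw [pow_zero, Subgroup.card_eq_one] at hs
      rw [hs, Subgroup.mem_bot] at hrK
      exact absurd hrK hr1
    · simpa using hs
  have hpow : ∀ k ∈ K, k ^ p = 1 := fun k hk => by
    have := Subgroup.pow_index_mem (⊥ : Subgroup K) ⟨k, hk⟩
    rw [Subgroup.index_bot, hcard, Subgroup.mem_bot] at this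
    simpa using congrArg Subtype.val this
  have hle : Subgroup.zpowers (c ^ r) = K := by
    have hz : Subgroup.zpowers (c ^ r) ≤ K := by simpa using hrK
    refine Subgroup.eq_of_le_of_card_ge hz ?_
    have : Fact p.Prime := ⟨hp⟩
    rw [Nat.card_zpowers, hcard, orderOf_eq_prime (hpow _ hrK) hr1]
  have hcen : ∀ k ∈ K, ∀ y, Commute k y := by
    intro k hk y
    obtain ⟨e, rfl⟩ := hle ▸ hk
    have h1 : c ^ (r * p) = 1 := by rw [zpow_mul, zpow_natCast]; exact hpow _ hrK
    rw [h.c_zpow_eq_one, sq] at h1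
    -- An element of order `p` in `⟨c⟩` lies in `⟨c ^ p⟩`.
    obtain ⟨r', rfl⟩ := Int.dvd_of_mul_dvd_mul_right (by exact_mod_cast hp.ne_zero) h1
    exact (h.commute_zpow_p r' y).zpow_left e
  obtain ⟨u, hu, v, hv, huv⟩ := hH
  exact huv (commute_of_forall_zpow_mul (exists_zpow_mul hx hgen)
    (fun k hk => (hcen k hk x).symm) (fun k hk l _ => hcen k hk l) u hu v hv)

/-- Again `H = ⟨x⟩ K`. The group `K` meets `⟨c⟩` nontrivially, so it suffices that its image under
`g` has order at least `p ^ (M - 1)`. A smaller image would consist of `p ^ 2`-th powers, and `K`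
would be central in `H`. -/
theorem le_card_of_commute_aux (h : IsBicyclicExtension p N M a b c f g) (hp : p.Prime)
    {H : Subgroup G} (hH : H.IsNonabelian) (hc : ∀ x ∈ H, Commute c x) {x : G} (hx : x ∈ H) {i : ℤ}
    (hf : f x = f a ^ i) (hi : ¬ (p : ℤ) ∣ i) : p ^ (N + M) ≤ Nat.card H := by
  have hfin := h.finite hp
  have hgen := h.generates_left hp hf hi
  set K : Subgroup G := H ⊓ f.ker with hK
  rw [h.card_eq_mul hx hgen, pow_add]
  refine Nat.mul_le_mul_left _ ?_
  rw [← hK]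
  obtain ⟨r, hr, hr1⟩ := h.exists_mem_zpowers_c hH
  have hrK : c ^ r ∈ K := ⟨hr, by simp [h.left_c]⟩
  obtain ⟨t, ht⟩ := h.exists_card_eq hp K
  have h1 := (g.comp K.subtype).ker.card_mul_index
  obtain ⟨s, -, hs⟩ := (Nat.dvd_prime_pow hp).1 (ht ▸ Subgroup.card_range_dvd (g.comp K.subtype))
  obtain ⟨e, -, he⟩ := (Nat.dvd_prime_pow hp).1
    (ht ▸ (g.comp K.subtype).ker.card_subgroup_dvd_card)
  have he0 : e ≠ 0 := by
    rintro rfl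
    rw [pow_zero, Subgroup.card_eq_one] at he
    have : (⟨c ^ r, hrK⟩ : K) ∈ (g.comp K.subtype).ker := by
      simp [MonoidHom.mem_ker, h.right_c]
    rw [he, Subgroup.mem_bot] at this
    exact hr1 (by simpa using congrArg Subtype.val this)
  rw [Subgroup.index_ker, hs, he, ← pow_add] at h1
  rw [← h1]
  refine Nat.pow_le_pow_right hp.pos ?_
  by_contra! hlt
  have hcom : ∀ k ∈ K, ∀ y ∈ H, Commute y k := by
    intro k hk y hy
    obtain ⟨l, hl⟩ := h.mem_zpowers_right (g k)
    have h2 : (g k) ^ p ^ s = 1 := by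
      have h3 := pow_card_eq_one' (x := (⟨g k, ⟨⟨k, hk⟩, rfl⟩⟩ : (g.comp K.subtype).range))
      rw [hs] at h3
      simpa using congrArg Subtype.val h3
    simp only at hl
    rw [← hl, ← zpow_natCast, ← zpow_mul, ← orderOf_dvd_iff_zpow_eq_one, h.orderOf_right] at h2
    have h4 : (p : ℤ) * p ∣ l := by
      have h5 : ((p : ℤ) ^ s) * (p * p) ∣ p ^ s * l := by
        -- As `e ≥ 1` and `e + s < M`, we have `s + 2 ≤ M`.
        refine dvd_trans ?_ (by simpa [mul_comm] using h2)
        rw [← sq, ← pow_add]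
        exact pow_dvd_pow _ (by omega)
      exact Int.dvd_of_mul_dvd_mul_left (pow_ne_zero _ (by exact_mod_cast hp.ne_zero)) h5
    obtain ⟨l', rfl⟩ := h4
    obtain ⟨q, hq⟩ := h.exists_eq_mul_c_zpow (x := k) (y := (b ^ l') ^ (p * p))
      (by simpa [h.left_b] using hk.2)
      (by rw [← hl, map_pow, map_zpow, ← zpow_natCast, ← zpow_mul]; push_cast; ring_nf)
    rw [hq]
    exact (h.commute_pow_sq y _).mul_right (((hc y hy).zpow_left q).symm)
  obtain ⟨u, hu, v, hv, huv⟩ := hH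
  exact huv (commute_of_forall_zpow_mul (exists_zpow_mul hx hgen)
    (fun k hk => hcom k hk x hx) (fun k hk l hl => hcom l hl k hk.1) u hu v hv)

theorem le_card_of_commute (h : IsBicyclicExtension p N M a b c f g) (hp : p.Prime)
    {H : Subgroup G} (hH : H.IsNonabelian) (hc : ∀ x ∈ H, Commute c x) :
    p ^ (N + M) ≤ Nat.card H := by
  obtain ⟨x, hx, i, j, hi, hj, hd | hd⟩ := h.exists_not_dvd hH
  · exact h.le_card_of_commute_aux hp hH hc hx hi hd
  · rw [add_comm]
    exact h.symm.le_card_of_commute_aux hp hH hc hx hj hd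

end IsBicyclicExtension

/-! ### Reduction of `I_max` to nonabelian subgroups, and its value in the two cases. -/

/-- A nonabelian subgroup of a finite group contains a minimal nonabelian subgroup. -/
theorem Subgroup.IsNonabelian.exists_isMinimalNonabelian {G : Type*} [Group G] [Finite G]
    {H : Subgroup G} (hH : H.IsNonabelian) : ∃ K ≤ H, IsMinimalNonabelian K := by
  obtain ⟨K, hKH, hK⟩ := (Set.toFinite {K : Subgroup G | K.IsNonabelian}).exists_le_minimal hH
  refine ⟨K, hKH, ?_, fun J hJ x hx y hy => ?_⟩
  · obtain ⟨x, hx, y, hy, hxy⟩ := hK.1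
    exact ⟨⟨x, hx⟩, ⟨y, hy⟩, fun h => hxy (by simpa using congrArg Subtype.val h)⟩
  · by_contra hxy
    have hJ' : (J.map K.subtype).IsNonabelian :=
      ⟨x, ⟨x, hx, rfl⟩, y, ⟨y, hy, rfl⟩, fun h => hxy (Subtype.ext (by simpa using h))⟩
    apply hJ
    rw [eq_top_iff]
    rintro z -
    obtain ⟨w, hw, hwz⟩ := hK.2 hJ' (by rintro _ ⟨w, -, rfl⟩; exact w.2) z.2
    rwa [← Subtype.ext (a1 := w) (a2 := z) hwz]

theorem IsMinimalNonabelian.isNonabelian {G : Type*} [Group G] {H : Subgroup G}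
    (hH : IsMinimalNonabelian H) : H.IsNonabelian := by
  obtain ⟨⟨x, y, hxy⟩, -⟩ := hH
  exact ⟨x, x.2, y, y.2, fun h => hxy (Subtype.ext h)⟩

namespace IsBicyclicExtension

variable {p N M : ℕ} {G A B : Type*} [Group G] [Group A] [Group B]
  {a b c : G} {f : G →* A} {g : G →* B}

theorem hasIMax_of_le (h : IsBicyclicExtension p N M a b c f g) (hp : p.Prime) {k l : ℕ}
    (hkl : k + l = N + M + 2) (hle : ∀ H : Subgroup G, H.IsNonabelian → p ^ l ≤ Nat.card H)
    (hex : ∃ H : Subgroup G, H.IsNonabelian ∧ p ^ k ≤ H.index) : HasIMax p G k := by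
  have hfin := h.finite hp
  have hub : ∀ H : Subgroup G, H.IsNonabelian → H.index ≤ p ^ k := by
    intro H hH
    have h1 := H.card_mul_index
    rw [h.card_eq, ← hkl, pow_add] at h1
    have h2 := hle H hH
    have h3 : 0 < p ^ l := pow_pos hp.pos _
    by_contra! hlt
    nlinarith
  refine ⟨hfin, IsPGroup.of_card h.card_eq, ?_, ?_⟩
  · obtain ⟨H, hH, hk⟩ := hex
    obtain ⟨K, hKH, hK⟩ := hH.exists_isMinimalNonabelian
    exact ⟨K, hK, le_antisymm (hub K hK.isNonabelian) (hk.trans (Subgroup.index_antitone hKH))⟩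
  · rintro _ ⟨H, hH, rfl⟩
    exact hub H hH.isNonabelian

theorem hasIMax_of_not_commute (h : IsBicyclicExtension p N M a b c f g) (hp : p.Prime)
    (hb : ¬ Commute c b) (hN : 2 ≤ N) (ha : Commute c a ∨ M ≤ N) : HasIMax p G N := by
  refine h.hasIMax_of_le hp (l := M + 2) (by ring) (fun H hH => ?_) ⟨f.ker, ?_, h.index_ker_left.ge⟩
  · by_cases hc : ∀ x ∈ H, Commute c x
    · exact (Nat.pow_le_pow_right hp.pos (by omega)).trans (h.le_card_of_commute hp hH hc)
    · push Not at hc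
      obtain ⟨x, hx, hcx⟩ := hc
      obtain ⟨i, j, k, hi, hj, hxe⟩ := h.exists_zpow x
      -- If `p ∤ j`, the element `x` generates the second quotient and the bound `p ^ (M + 2)` is
      -- immediate. If `p ∣ j`, the failure of `x` to centralize `c` comes from `a`, which forces `M
      -- ≤ N` and `p ∤ i`.
      by_cases hdj : (p : ℤ) ∣ j
      · obtain ⟨j, rfl⟩ := hdj
        rcases ha with ha | hMN
        · refine absurd ?_ hcx
          rw [hxe, mul_comm (p : ℤ), zpow_mul, zpow_natCast]
          exact ((ha.zpow_right i).mul_right (h.commute_c_pow _)).mul_right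
            ((Commute.refl c).zpow_right k)
        · by_cases hdi : (p : ℤ) ∣ i
          · obtain ⟨i, rfl⟩ := hdi
            obtain ⟨y, q, hy⟩ := h.exists_eq_pow_mul_c_zpow hi hj
            exact absurd (h.commute_c_of_pow hy) hcx
          · exact (Nat.pow_le_pow_right hp.pos (by omega)).trans
              (h.le_card_of_not_commute hp hH hx hi hdi)
      · exact h.symm.le_card_of_not_commute hp hH hx hj hdj
  · exact ⟨c, h.left_c, b, h.left_b, hb⟩

/-- The subgroup generated by `a ^ p`, `b` and `c ^ p`. -/
def powSubgroup (h : IsBicyclicExtension p N M a b c f g) : Subgroup G where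
  carrier := {x | ∃ i j k : ℤ, x = (a ^ i) ^ p * b ^ j * c ^ (p * k)}
  one_mem' := ⟨0, 0, 0, by simp⟩
  mul_mem' := by
    rintro _ _ ⟨i, j, k, rfl⟩ ⟨i', j', k', rfl⟩
    obtain ⟨s, hs⟩ := h.exists_comm_pow (b ^ j) (a ^ i')
    refine ⟨i + i', j + j', s + k + k', ?_⟩
    have h1 : (a ^ (i + i')) ^ p = (a ^ i) ^ p * (a ^ i') ^ p := by
      rw [zpow_add, ((Commute.refl a).zpow_zpow i i').mul_pow]
    calc _ = (a ^ i) ^ p * b ^ j * (c ^ ((p : ℤ) * k) * ((a ^ i') ^ p * b ^ j'))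
            * c ^ ((p : ℤ) * k') := by group
      _ = (a ^ i) ^ p * (b ^ j * (a ^ i') ^ p) * b ^ j' * c ^ ((p : ℤ) * k)
            * c ^ ((p : ℤ) * k') := by rw [(h.commute_zpow_p k _).eq]; simp only [mul_assoc]
      _ = (a ^ i) ^ p * (a ^ i') ^ p * b ^ j * (c ^ ((p : ℤ) * s) * b ^ j') * c ^ ((p : ℤ) * k)
            * c ^ ((p : ℤ) * k') := by rw [hs]; simp only [mul_assoc]
      _ = _ := by
        rw [(h.commute_zpow_p s _).eq, h1, zpow_add b, mul_add, mul_add, zpow_add c, zpow_add c]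
        simp only [mul_assoc]
  inv_mem' := by
    rintro _ ⟨i, j, k, rfl⟩
    obtain ⟨s, hs⟩ := h.exists_comm_pow (b ^ (-j)) (a ^ (-i))
    refine ⟨-i, -j, s - k, ?_⟩
    rw [mul_inv_rev, mul_inv_rev, ← zpow_neg, ← zpow_neg, ← inv_pow, ← zpow_neg, hs,
      ← mul_neg, (h.commute_zpow_p _ _).eq, mul_assoc _ (c ^ _), ← zpow_add, ← mul_add,
      sub_eq_add_neg]

/-- Comparing images under `f` and `g`, an expression for `c` would involve only powers of `a ^ p ^
N`, `b ^ p ^ M` and `c ^ p`, all in `⟨c ^ p⟩`. -/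
theorem c_notMem_powSubgroup (h : IsBicyclicExtension p N M a b c f g) (hp : p.Prime) :
    c ∉ h.powSubgroup := by
  rintro ⟨i, j, k, hc⟩
  have hi : (p : ℤ) ^ N ∣ i * p := by
    have := congrArg f hc
    simp only [h.left_c, h.left_b, map_mul, map_pow, map_zpow, one_zpow, mul_one] at this
    rw [← zpow_natCast, ← zpow_mul, eq_comm, ← orderOf_dvd_iff_zpow_eq_one, h.orderOf_left] at this
    exact_mod_cast this
  have hj : (p : ℤ) ^ M ∣ j := by
    have := congrArg g hc
    simp only [h.right_c, h.right_a, map_mul, map_pow, map_zpow, one_zpow, mul_one, one_pow,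
      one_mul] at this
    rw [eq_comm, ← orderOf_dvd_iff_zpow_eq_one, h.orderOf_right] at this
    exact_mod_cast this
  obtain ⟨q, hq⟩ := hi
  obtain ⟨r, rfl⟩ := hj
  obtain ⟨u, hu⟩ := h.pow_left
  obtain ⟨v, hv⟩ := h.pow_right
  simp only at hu hv
  rw [← zpow_natCast, ← zpow_mul, hq, zpow_mul, zpow_mul,
    show a ^ (p : ℤ) ^ N = a ^ p ^ N by rw [← zpow_natCast]; push_cast; rfl, ← hu,
    show b ^ (p : ℤ) ^ M = b ^ p ^ M by rw [← zpow_natCast]; push_cast; rfl, ← hv,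
    ← zpow_natCast, ← zpow_mul, ← zpow_mul, ← zpow_mul, ← zpow_mul, ← zpow_add, ← zpow_add] at hc
  have h1 : c ^ (1 - ((p : ℤ) * (u * q) + p * (v * r) + p * k)) = 1 := by
    rw [zpow_sub, ← hc, zpow_one, mul_inv_cancel]
  rw [h.c_zpow_eq_one] at h1
  have h2 : (p : ℤ) ∣ 1 := by
    have h3 := (dvd_pow_self (p : ℤ) two_ne_zero).trans h1
    rwa [show 1 - ((p : ℤ) * (u * q) + p * (v * r) + p * k) = 1 - p * (u * q + v * r + k) by ring,
      dvd_sub_left (dvd_mul_right _ _)] at h3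
  exact (Nat.prime_iff_prime_int.1 hp).not_dvd_one h2

theorem hasIMax_two_of_commute (h : IsBicyclicExtension p N M a b c f g) (hp : p.Prime)
    (hN : 1 ≤ N) (hc : ∀ x, Commute c x) (hab : a * b = b * a * c) : HasIMax p G 2 := by
  have hfin := h.finite hp
  refine h.hasIMax_of_le hp (l := N + M) (by ring)
    (fun H hH => h.le_card_of_commute hp hH fun x _ => hc x) ⟨h.powSubgroup, ?_, ?_⟩
  · refine ⟨a ^ p, ⟨1, 0, 0, by simp⟩, b, ⟨0, 1, 0, by simp⟩, fun heq => ?_⟩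
    have key : ∀ k : ℕ, a ^ k * b = b * a ^ k * c ^ k := by
      intro k
      induction k with
      | zero => simp
      | succ k ih =>
        rw [pow_succ', mul_assoc, ih, ← mul_assoc, ← mul_assoc, hab, mul_assoc (b * a), (hc _).eq,
          ← mul_assoc, mul_assoc _ c, pow_succ' c, mul_assoc b]
    rw [key, mul_eq_left, ← zpow_natCast, h.c_zpow_eq_one] at heq
    have h1 : p ^ 2 ∣ p ^ 1 := by rw [pow_one]; exact_mod_cast heq
    exact absurd ((Nat.pow_dvd_pow_iff_le_right hp.one_lt).1 h1) (by norm_num)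
  -- Two proper inclusions `powSubgroup < H' < G`, separated by `c` and by `a`, give index at least
  -- `p ^ 2`.
  · set H' : Subgroup G := (Subgroup.zpowers (f a ^ p)).comap f with hH'
    have hle : h.powSubgroup ≤ H' := by
      rintro _ ⟨i, j, k, rfl⟩
      exact ⟨i, by simp [h.left_b, h.left_c, ← zpow_natCast, ← zpow_mul, mul_comm]⟩
    have h1 : h.powSubgroup.relIndex H' ≠ 1 := by
      rw [Ne, Subgroup.relIndex_eq_one]
      exact fun hle' => h.c_notMem_powSubgroup hp
        (hle' (by simp [hH', Subgroup.mem_comap, h.left_c]))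
    have h2 : H'.index ≠ 1 := by
      rw [Ne, Subgroup.index_eq_one]
      intro htop
      obtain ⟨i, hi⟩ : a ∈ H' := htop ▸ Subgroup.mem_top a
      simp only at hi
      have h3 : f a ^ (1 - (p : ℤ) * i) = 1 := by
        rw [zpow_sub, zpow_mul, zpow_natCast, hi, zpow_one, mul_inv_cancel]
      rw [← orderOf_dvd_iff_zpow_eq_one, h.orderOf_left] at h3
      have h4 : (p : ℤ) ∣ 1 - p * i :=
        (Int.natCast_dvd_natCast.2 (dvd_pow_self p (by omega))).trans h3
      rw [dvd_sub_left (dvd_mul_right _ _)] at h4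
      exact (Nat.prime_iff_prime_int.1 hp).not_dvd_one h4
    have hmul := Subgroup.relIndex_mul_index hle
    have hdvd : h.powSubgroup.index ∣ p ^ (N + M + 2) := h.card_eq ▸ h.powSubgroup.index_dvd_card
    have hge : ∀ q : ℕ, q ∣ p ^ (N + M + 2) → q ≠ 1 → p ≤ q := by
      intro q hq hq1
      obtain ⟨s, -, rfl⟩ := (Nat.dvd_prime_pow hp).1 hq
      exact Nat.le_self_pow (by rintro rfl; simp at hq1) p
    rw [← hmul, sq]
    exact Nat.mul_le_mul (hge _ ((Dvd.intro _ hmul).trans hdvd) h1)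
      (hge _ ((Dvd.intro_left _ hmul).trans hdvd) h2)

end IsBicyclicExtension

/-! ### An explicit group in which `c ^ p ≠ 1`. -/

/-- The integer `i (i - 1) / 2`. -/
def Int.chooseTwo (i : ℤ) : ℤ := i * (i - 1) / 2

theorem Int.two_mul_chooseTwo (i : ℤ) : 2 * i.chooseTwo = i * (i - 1) :=
  Int.mul_ediv_cancel' (Int.even_mul_pred_self i).two_dvd

theorem Int.chooseTwo_add (i j : ℤ) :
    (i + j).chooseTwo = i.chooseTwo + j.chooseTwo + i * j := by
  have h1 := (i + j).two_mul_chooseTwo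
  have h2 := i.two_mul_chooseTwo
  have h3 := j.two_mul_chooseTwo
  linarith

theorem Int.chooseTwo_mul (i j : ℤ) :
    (i * j).chooseTwo = j * i.chooseTwo + i ^ 2 * j.chooseTwo := by
  have h1 := (i * j).two_mul_chooseTwo
  have h2 := i.two_mul_chooseTwo
  have h3 := j.two_mul_chooseTwo
  refine mul_left_cancel₀ two_ne_zero (?_ : (2 : ℤ) * _ = 2 * _)
  linear_combination h1 - j * h2 - i ^ 2 * h3

theorem Int.chooseTwo_neg (i : ℤ) : (-i).chooseTwo = i.chooseTwo + i := by
  have h1 := (-i).two_mul_chooseTwo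
  have h2 := i.two_mul_chooseTwo
  linarith

/-- The group of the elements `a ^ i * b ^ j * c ^ k` with integers `i`, `j` and with `k` in a
ring `R`, where `[a, b] = c`, `[c, a] = c ^ α`, `[c, b] = c ^ β` and all products of `α` and `β`
vanish. -/
@[ext] structure ClassThreeGroup (R : Type) [CommRing R] (α β : R) : Type where
  i : ℤ
  j : ℤ
  k : R

namespace ClassThreeGroup

variable {R : Type} [CommRing R] {α β : R}

/-- The exponent of `c` in the commutator `[a ^ i, b ^ j]`. -/
def commExp (α β : R) (i j : ℤ) : R :=
  i * j + α * j * i.chooseTwo + β * i * j.chooseTwo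

/-- This is collection to normal form: `b ^ x.j` moves past `a ^ y.i` at the cost of `c ^
(-commExp)`, and moving powers of `c` to the right multiplies exponents by `1 + i α + j β`. Keeping
the exponents of `a` and `b` in `ℤ` makes the power relations a separate central quotient. -/
instance : Mul (ClassThreeGroup R α β) where
  mul x y := ⟨x.i + y.i, x.j + y.j,
    x.k * (1 + y.i * α + y.j * β) + y.k - commExp α β y.i x.j * (1 + y.j * β)⟩

instance : One (ClassThreeGroup R α β) where
  one := ⟨0, 0, 0⟩

instance : Inv (ClassThreeGroup R α β) where
  inv x := ⟨-x.i, -x.j, -(x.k * (1 - x.i * α - x.j * β)) +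
    commExp α β (-x.i) x.j * (1 - x.j * β)⟩

theorem mul_def (x y : ClassThreeGroup R α β) : x * y = ⟨x.i + y.i, x.j + y.j,
    x.k * (1 + y.i * α + y.j * β) + y.k - commExp α β y.i x.j * (1 + y.j * β)⟩ := rfl

theorem one_def : (1 : ClassThreeGroup R α β) = ⟨0, 0, 0⟩ := rfl

theorem inv_def (x : ClassThreeGroup R α β) : x⁻¹ = ⟨-x.i, -x.j,
    -(x.k * (1 - x.i * α - x.j * β)) + commExp α β (-x.i) x.j * (1 - x.j * β)⟩ := rfl

variable [haa : Fact (α * α = 0)] [hab : Fact (α * β = 0)] [hbb : Fact (β * β = 0)]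

instance : Group (ClassThreeGroup R α β) :=
  Group.ofLeftAxioms
    (by
      have haa := haa.out
      have hab := hab.out
      have hbb := hbb.out
      rintro ⟨i, j, k⟩ ⟨i', j', k'⟩ ⟨i'', j'', k''⟩
      simp only [mul_def, commExp, mk.injEq, add_assoc, true_and, Int.chooseTwo_add]
      push_cast
      grind)
    (by
      rintro ⟨i, j, k⟩
      simp [mul_def, one_def, commExp, Int.chooseTwo])
    (by
      have haa := haa.out
      have hab := hab.out
      have hbb := hbb.out
      rintro ⟨i, j, k⟩
      simp only [mul_def, one_def, inv_def, commExp, mk.injEq, neg_add_cancel, true_and,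
        Int.chooseTwo_neg]
      have hi : (2 : R) * i.chooseTwo = i * (i - 1) := by exact_mod_cast congrArg _ i.two_mul_chooseTwo
      have hj : (2 : R) * j.chooseTwo = j * (j - 1) := by exact_mod_cast congrArg _ j.two_mul_chooseTwo
      push_cast
      grind)

end ClassThreeGroup

theorem GroupLabel.comm_eq_iff {G : Type*} [Group G] {x y z : G} :
    GroupLabel.comm x y = z ↔ x * y = y * x * z := by
  rw [GroupLabel.comm]
  constructor
  · rintro rfl; group
  · intro h; rw [mul_assoc, h]; group

/-- The relations to which those of each type are equivalent, for suitable parameters. -/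
structure UniformRelations (p N M α β ε δ : ℕ) {G : Type*} [Group G] (a b c : G) : Prop where
  a_pow : a ^ p ^ N = c ^ (p * ε)
  b_pow : b ^ p ^ M = c ^ (p * δ)
  c_pow : c ^ p ^ 2 = 1
  comm_ab : GroupLabel.comm a b = c
  comm_ca : GroupLabel.comm c a = c ^ (p * α)
  comm_cb : GroupLabel.comm c b = c ^ (p * β)

namespace ClassThreeGroup

variable {R : Type} [CommRing R] {α β : R}

/-- The conditions under which `a ^ P * c ^ (-E)` and `b ^ Q * c ^ (-D)` are central. -/
structure IsCentralData (α β : R) (P Q : ℤ) (E D : R) : Prop where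
  P_α : P * α = 0
  P_β : P * β = 0
  Q_α : Q * α = 0
  Q_β : Q * β = 0
  E_α : E * α = 0
  E_β : E * β = 0
  D_α : D * α = 0
  D_β : D * β = 0
  P_add : P + α * P.chooseTwo = 0
  Q_add : Q + β * Q.chooseTwo = 0

variable {P Q : ℤ} {E D : R}

theorem IsCentralData.commExp_left (h : IsCentralData α β P Q E D) (r j : ℤ) :
    commExp α β (P * r) j = 0 := by
  have h1 := h.P_α
  have h2 := h.P_β
  have h3 := h.P_add
  rw [commExp, Int.chooseTwo_mul]
  push_cast
  linear_combination j * r * h3 + j * P * r.chooseTwo * h1 + r * j.chooseTwo * h2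

theorem IsCentralData.commExp_right (h : IsCentralData α β P Q E D) (i s : ℤ) :
    commExp α β i (Q * s) = 0 := by
  have h1 := h.Q_α
  have h2 := h.Q_β
  have h3 := h.Q_add
  rw [commExp, Int.chooseTwo_mul]
  push_cast
  linear_combination i * s * h3 + i * Q * s.chooseTwo * h2 + s * i.chooseTwo * h1

theorem IsCentralData.mul_left (h : IsCentralData α β P Q E D) (r s : ℤ)
    (x : ClassThreeGroup R α β) : (⟨P * r, Q * s, -(E * r + D * s)⟩ : ClassThreeGroup R α β) * x =
      ⟨P * r + x.i, Q * s + x.j, -(E * r + D * s) + x.k⟩ := by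
  simp only [mul_def, h.commExp_right, mk.injEq, true_and]
  linear_combination -(r * x.i) * h.E_α - r * x.j * h.E_β - s * x.i * h.D_α - s * x.j * h.D_β

theorem IsCentralData.mul_right (h : IsCentralData α β P Q E D) (r s : ℤ)
    (x : ClassThreeGroup R α β) : x * (⟨P * r, Q * s, -(E * r + D * s)⟩ : ClassThreeGroup R α β) =
      ⟨P * r + x.i, Q * s + x.j, -(E * r + D * s) + x.k⟩ := by
  simp only [mul_def, h.commExp_left, mk.injEq, add_comm x.i, add_comm x.j, true_and]
  push_cast
  linear_combination r * x.k * h.P_α + s * x.k * h.Q_β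

variable [haa : Fact (α * α = 0)] [hab : Fact (α * β = 0)] [hbb : Fact (β * β = 0)]

/-- The central subgroup generated by `a ^ P * c ^ (-E)` and `b ^ Q * c ^ (-D)`. -/
def centralSubgroup (h : IsCentralData α β P Q E D) : Subgroup (ClassThreeGroup R α β) where
  carrier := {x | ∃ r s : ℤ, x = ⟨P * r, Q * s, -(E * r + D * s)⟩}
  one_mem' := ⟨0, 0, by simp [one_def]⟩
  mul_mem' := by
    rintro _ _ ⟨r, s, rfl⟩ ⟨r', s', rfl⟩
    refine ⟨r + r', s + s', ?_⟩
    rw [h.mul_left, mk.injEq]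
    refine ⟨by ring, by ring, by push_cast; ring⟩
  inv_mem' := by
    rintro _ ⟨r, s, rfl⟩
    refine ⟨-r, -s, ?_⟩
    rw [inv_eq_iff_mul_eq_one, h.mul_left, one_def, mk.injEq]
    refine ⟨by ring, by ring, by push_cast; ring⟩

theorem mem_centralSubgroup (h : IsCentralData α β P Q E D) (x : ClassThreeGroup R α β) :
    x ∈ centralSubgroup h ↔ ∃ r s : ℤ, x = ⟨P * r, Q * s, -(E * r + D * s)⟩ := Iff.rfl

theorem normal_centralSubgroup (h : IsCentralData α β P Q E D) :
    (centralSubgroup h).Normal := by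
  constructor
  rintro _ ⟨r, s, rfl⟩ x
  rw [h.mul_right, ← h.mul_left, mul_inv_cancel_right]
  exact ⟨r, s, rfl⟩

theorem gen_a_pow (k : ℕ) : (⟨1, 0, 0⟩ : ClassThreeGroup R α β) ^ k = ⟨k, 0, 0⟩ := by
  induction k with
  | zero => simp [one_def]
  | succ k ih => rw [pow_succ, ih, mul_def]; simp [commExp, Int.chooseTwo]

theorem gen_b_pow (k : ℕ) : (⟨0, 1, 0⟩ : ClassThreeGroup R α β) ^ k = ⟨0, k, 0⟩ := by
  induction k with
  | zero => simp [one_def]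
  | succ k ih => rw [pow_succ, ih, mul_def]; simp [commExp, Int.chooseTwo]

theorem gen_c_pow (k : ℕ) : (⟨0, 0, 1⟩ : ClassThreeGroup R α β) ^ k = ⟨0, 0, k⟩ := by
  induction k with
  | zero => simp [one_def]
  | succ k ih => rw [pow_succ, ih, mul_def]; simp [commExp, Int.chooseTwo]

end ClassThreeGroup

open ClassThreeGroup in
/-- The relations do not imply `c ^ p = 1`. -/
theorem UniformRelations.exists_pow_ne_one {p N M : ℕ} (α β ε δ : ℕ) (hp : p.Prime)
    (hN : 1 ≤ N) (hM : 1 ≤ M)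
    (hα : (p : ℤ) ^ 2 ∣ p ^ N + p * α * ((p : ℤ) ^ N).chooseTwo)
    (hβ : (p : ℤ) ^ 2 ∣ p ^ M + p * β * ((p : ℤ) ^ M).chooseTwo) :
    ∃ (Q : Type) (_ : Group Q) (a b c : Q),
      UniformRelations p N M α β ε δ a b c ∧ c ^ p ≠ 1 := by
  have hpp : (p : ZMod (p ^ 2)) * p = 0 := by
    rw [← sq]; exact_mod_cast ZMod.natCast_self (p ^ 2)
  have hppx : ∀ x y : ZMod (p ^ 2), (p : ZMod (p ^ 2)) * x * ((p : ZMod (p ^ 2)) * y) = 0 := fun x y => by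
    linear_combination x * y * hpp
  have hpow : ∀ {n : ℕ}, 1 ≤ n → ∃ x : ZMod (p ^ 2), (p : ZMod (p ^ 2)) ^ n = (p : ZMod (p ^ 2)) * x := by
    intro n hn
    obtain ⟨m, rfl⟩ := Nat.exists_eq_add_of_le' hn
    exact ⟨p ^ m, pow_succ' _ _⟩
  obtain ⟨x, hx⟩ := hpow hN
  obtain ⟨y, hy⟩ := hpow hM
  have hcast : ∀ z : ℤ, (p : ℤ) ^ 2 ∣ z → (z : ZMod (p ^ 2)) = 0 := fun z hz => by
    rw [ZMod.intCast_zmod_eq_zero_iff_dvd]; exact_mod_cast hz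
  -- Dividing by `⟨a ^ P * c ^ (-E), b ^ Q * c ^ (-D)⟩` imposes the two power relations. Centrality
  -- requires `[a ^ P, b] = 1` and `[a, b ^ Q] = 1`, which is what `hα` and `hβ` provide.
  have h : IsCentralData ((p : ZMod (p ^ 2)) * α) (p * β) ((p : ℤ) ^ N) ((p : ℤ) ^ M)
      (p * ε) (p * δ) := by
    refine ⟨?_, ?_, ?_, ?_, hppx _ _, hppx _ _, hppx _ _, hppx _ _, ?_, ?_⟩
    · push_cast; rw [hx]; exact hppx _ _
    · push_cast; rw [hx]; exact hppx _ _
    · push_cast; rw [hy]; exact hppx _ _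
    · push_cast; rw [hy]; exact hppx _ _
    · exact_mod_cast hcast _ hα
    · exact_mod_cast hcast _ hβ
  have : Fact ((p : ZMod (p ^ 2)) * α * (p * α) = 0) := ⟨hppx _ _⟩
  have : Fact ((p : ZMod (p ^ 2)) * α * (p * β) = 0) := ⟨hppx _ _⟩
  have : Fact ((p : ZMod (p ^ 2)) * β * (p * β) = 0) := ⟨hppx _ _⟩
  have := normal_centralSubgroup h
  refine ⟨_ ⧸ centralSubgroup h, inferInstance, QuotientGroup.mk ⟨1, 0, 0⟩,
    QuotientGroup.mk ⟨0, 1, 0⟩, QuotientGroup.mk ⟨0, 0, 1⟩, ⟨?_, ?_, ?_, ?_, ?_, ?_⟩, ?_⟩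
  · rw [← QuotientGroup.mk_pow, ← QuotientGroup.mk_pow, eq_comm, QuotientGroup.eq, gen_a_pow, gen_c_pow]
    refine ⟨1, 0, ?_⟩
    rw [inv_mul_eq_iff_eq_mul, h.mul_right]
    simp
  · rw [← QuotientGroup.mk_pow, ← QuotientGroup.mk_pow, eq_comm, QuotientGroup.eq, gen_b_pow, gen_c_pow]
    refine ⟨0, 1, ?_⟩
    rw [inv_mul_eq_iff_eq_mul, h.mul_right]
    simp
  · rw [← QuotientGroup.mk_pow, gen_c_pow]
    rw [ZMod.natCast_self (p ^ 2)]; rfl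
  · rw [GroupLabel.comm_eq_iff, ← QuotientGroup.mk_mul, ← QuotientGroup.mk_mul,
      ← QuotientGroup.mk_mul]
    congr 1
    simp [mul_def, commExp, Int.chooseTwo]
  · rw [GroupLabel.comm_eq_iff, ← QuotientGroup.mk_pow, ← QuotientGroup.mk_mul,
      ← QuotientGroup.mk_mul, ← QuotientGroup.mk_mul, gen_c_pow]
    congr 1
    simp [mul_def, commExp, Int.chooseTwo]
  · rw [GroupLabel.comm_eq_iff, ← QuotientGroup.mk_pow, ← QuotientGroup.mk_mul,
      ← QuotientGroup.mk_mul, ← QuotientGroup.mk_mul, gen_c_pow]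
    congr 1
    simp [mul_def, commExp, Int.chooseTwo]
  · rw [← QuotientGroup.mk_pow, gen_c_pow, Ne, QuotientGroup.eq_one_iff, mem_centralSubgroup]
    rintro ⟨r, s, hrs⟩
    rw [mk.injEq] at hrs
    obtain ⟨h1, h2, h3⟩ := hrs
    -- The exponents of `a` and `b` are integers and `p ^ N`, `p ^ M` are nonzero, so the subgroup
    -- meets `⟨c⟩` trivially.
    obtain rfl : r = 0 := by simpa [hp.ne_zero] using h1.symm
    obtain rfl : s = 0 := by simpa [hp.ne_zero] using h2.symm
    simp only [Int.cast_zero, mul_zero, add_zero, neg_zero, ZMod.natCast_eq_zero_iff] at h3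
    have h4 := (Nat.pow_dvd_pow_iff_le_right (x := p) (k := 2) (l := 1) hp.one_lt).1 (by simpa using h3)
    omega

/-! ### From a universal triple to a bicyclic extension. -/

/-- `G` is generated by `a`, `b`, `c`, subject to the property `R` of triples of elements. -/
structure IsUniversalTriple (R : ∀ {Q : Type} [Group Q], Q → Q → Q → Prop) {G : Type*} [Group G]
    (a b c : G) : Prop where
  closure_eq : Subgroup.closure {a, b, c} = ⊤
  exists_hom : ∀ {Q : Type} [Group Q] (x y z : Q), R x y z →
    ∃ φ : G →* Q, φ a = x ∧ φ b = y ∧ φ c = z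

namespace UniformRelations

variable {p N M α β ε δ : ℕ} {G : Type*} [Group G] {a b c : G}

/-- The property holds for the generators and is multiplicative; for inverses, `(1 + p w)(1 - p w)`
is `1` modulo `p ^ 2`. -/
theorem exists_conj (h : UniformRelations p N M α β ε δ a b c)
    (hcl : Subgroup.closure {a, b, c} = ⊤) (x : G) : ∃ w : ℤ, c * x = x * c ^ (1 + p * w) := by
  have hpow : ∀ {x : G} {w : ℤ}, c * x = x * c ^ (1 + p * w) →
      ∀ k : ℤ, c ^ k * x = x * c ^ ((1 + p * w) * k) := by
    intro x w hw k
    have : c ^ k = x * (c ^ (1 + p * w)) ^ k * x⁻¹ := by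
      rw [← conj_zpow]; congr 1; rw [← hw]; group
    rw [this, ← zpow_mul]; group
  have hx : x ∈ Subgroup.closure {a, b, c} := hcl ▸ Subgroup.mem_top x
  induction hx using Subgroup.closure_induction with
  | mem x hx =>
    rcases hx with rfl | rfl | rfl
    · refine ⟨α, ?_⟩
      rw [GroupLabel.comm_eq_iff.1 h.comm_ca, zpow_one_add, ← mul_assoc]
      exact_mod_cast rfl
    · refine ⟨β, ?_⟩
      rw [GroupLabel.comm_eq_iff.1 h.comm_cb, zpow_one_add, ← mul_assoc]
      exact_mod_cast rfl
    · exact ⟨0, by simp⟩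
  | one => exact ⟨0, by simp⟩
  | mul x y _ _ hx hy =>
    obtain ⟨v, hv⟩ := hx
    obtain ⟨w, hw⟩ := hy
    refine ⟨v + w + p * v * w, ?_⟩
    rw [← mul_assoc, hv, mul_assoc, hpow hw, ← mul_assoc]
    congr 2; ring
  | inv x _ hx =>
    obtain ⟨w, hw⟩ := hx
    refine ⟨-w, ?_⟩
    have h1 := hpow hw (1 + p * -w)
    have h2 : c ^ ((1 + (p : ℤ) * w) * (1 + p * -w)) = c := by
      have h3 : c ^ ((p : ℤ) ^ 2) = 1 := by exact_mod_cast h.c_pow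
      rw [show (1 + (p : ℤ) * w) * (1 + p * -w) = 1 + p ^ 2 * (-w ^ 2) by ring, zpow_add, zpow_mul,
        h3, one_zpow, zpow_one, mul_one]
    rw [h2] at h1
    rw [eq_inv_mul_iff_mul_eq, ← mul_assoc, ← h1, mul_inv_cancel_right]

theorem exists_zpow_mul_zpow (h : UniformRelations p N M α β ε δ a b c)
    (hcl : Subgroup.closure {a, b, c} = ⊤) (x : G) :
    ∃ i j k : ℤ, x = a ^ i * b ^ j * c ^ k := by
  have hD : (Subgroup.zpowers c).Normal := by
    constructor
    rintro _ ⟨k, rfl⟩ x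
    obtain ⟨w, hw⟩ := h.exists_conj hcl x⁻¹
    refine ⟨(1 + p * w) * k, ?_⟩
    simp only
    rw [← conj_zpow, mul_assoc, hw, mul_inv_cancel_left, zpow_mul]
  have hc : (QuotientGroup.mk c : G ⧸ Subgroup.zpowers c) = 1 :=
    (QuotientGroup.eq_one_iff _).2 (Subgroup.mem_zpowers c)
  have hab : Commute (QuotientGroup.mk a : G ⧸ Subgroup.zpowers c) (QuotientGroup.mk b) := by
    rw [commute_iff_eq, ← QuotientGroup.mk_mul, GroupLabel.comm_eq_iff.1 h.comm_ab,
      QuotientGroup.mk_mul, hc, mul_one, QuotientGroup.mk_mul]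
  suffices H : ∃ i j : ℤ, (QuotientGroup.mk x : G ⧸ Subgroup.zpowers c) =
      QuotientGroup.mk a ^ i * QuotientGroup.mk b ^ j by
    obtain ⟨i, j, hij⟩ := H
    rw [← QuotientGroup.mk_zpow, ← QuotientGroup.mk_zpow, ← QuotientGroup.mk_mul, eq_comm,
      QuotientGroup.eq] at hij
    obtain ⟨k, hk⟩ := hij
    exact ⟨i, j, k, by simp only at hk; rw [hk, mul_inv_cancel_left]⟩
  have hx : x ∈ Subgroup.closure {a, b, c} := hcl ▸ Subgroup.mem_top x
  induction hx using Subgroup.closure_induction with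
  | mem x hx =>
    rcases hx with rfl | rfl | rfl
    · exact ⟨1, 0, by simp⟩
    · exact ⟨0, 1, by simp⟩
    · exact ⟨0, 0, by simp [hc]⟩
  | one => exact ⟨0, 0, by simp⟩
  | mul x y _ _ hx hy =>
    obtain ⟨i, j, hx⟩ := hx
    obtain ⟨i', j', hy⟩ := hy
    refine ⟨i + i', j + j', ?_⟩
    rw [QuotientGroup.mk_mul, hx, hy, zpow_add, zpow_add, mul_assoc, ← mul_assoc (_ ^ j),
      ← (hab.zpow_zpow i' j).eq]
    simp only [mul_assoc]
  | inv x _ hx =>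
    obtain ⟨i, j, hx⟩ := hx
    refine ⟨-i, -j, ?_⟩
    rw [QuotientGroup.mk_inv, hx, mul_inv_rev, zpow_neg, zpow_neg,
      (hab.zpow_zpow i j).inv_inv.eq]

/-- The relations hold in the cyclic group of order `p ^ N` for its generator and `1`, `1`. -/
theorem ofAdd_one : UniformRelations p N M α β ε δ
    (Multiplicative.ofAdd (1 : ZMod (p ^ N))) 1 1 := by
  refine ⟨?_, by simp, by simp, by simp [GroupLabel.comm], by simp [GroupLabel.comm],
    by simp [GroupLabel.comm]⟩
  rw [one_pow, ← ofAdd_nsmul, nsmul_one, ZMod.natCast_self, ofAdd_zero]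

theorem one_ofAdd_one : UniformRelations p N M α β ε δ
    1 (Multiplicative.ofAdd (1 : ZMod (p ^ M))) 1 := by
  refine ⟨by simp, ?_, by simp, by simp [GroupLabel.comm], by simp [GroupLabel.comm],
    by simp [GroupLabel.comm]⟩
  rw [one_pow, ← ofAdd_nsmul, nsmul_one, ZMod.natCast_self, ofAdd_zero]

/-- Universality supplies `f` and `g` as maps to cyclic groups killing `c` and one other generator,
and a map to the explicit group that detects `c ^ p ≠ 1`. The normal form `a ^ i * b ^ j * c ^ k`
shows that the common kernel is no larger than `⟨c⟩`. -/
theorem exists_isBicyclicExtension (h : UniformRelations p N M α β ε δ a b c) (hp : p.Prime)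
    (hu : IsUniversalTriple (fun x y z => UniformRelations p N M α β ε δ x y z) a b c)
    (hN : 1 ≤ N) (hM : 1 ≤ M)
    (hα : (p : ℤ) ^ 2 ∣ p ^ N + p * α * ((p : ℤ) ^ N).chooseTwo)
    (hβ : (p : ℤ) ^ 2 ∣ p ^ M + p * β * ((p : ℤ) ^ M).chooseTwo) :
    ∃ (f : G →* Multiplicative (ZMod (p ^ N))) (g : G →* Multiplicative (ZMod (p ^ M))),
      IsBicyclicExtension p N M a b c f g := by
  have hmem : ∀ (n : ℕ) (x : Multiplicative (ZMod n)),
      x ∈ Subgroup.zpowers (Multiplicative.ofAdd (1 : ZMod n)) := by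
    intro n x
    obtain ⟨k, hk⟩ := ZMod.intCast_surjective x.toAdd
    refine ⟨k, ?_⟩
    simp only
    rw [← ofAdd_zsmul, zsmul_one, hk, ofAdd_toAdd]
  have hord : ∀ n : ℕ, orderOf (Multiplicative.ofAdd (1 : ZMod n)) = n := fun n => by
    rw [orderOf_ofAdd_eq_addOrderOf, ZMod.addOrderOf_one]
  have hfact : Fact p.Prime := ⟨hp⟩
  obtain ⟨f, fa, fb, fc⟩ := hu.exists_hom _ _ _ (ofAdd_one (p := p) (N := N) (M := M))
  obtain ⟨g, ga, gb, gc⟩ := hu.exists_hom _ _ _ (one_ofAdd_one (p := p) (N := N) (M := M))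
  have hcp : c ^ p ≠ 1 := by
    obtain ⟨Q, _, x, y, z, hxyz, hz⟩ := exists_pow_ne_one α β ε δ hp hN hM hα hβ
    obtain ⟨φ, -, -, rfl⟩ := hu.exists_hom x y z hxyz
    exact fun h1 => hz (by rw [← map_pow, h1, map_one])
  have hpa : a ^ p ^ N ∈ Subgroup.zpowers (c ^ p) := by
    rw [h.a_pow, pow_mul]; exact Subgroup.npow_mem_zpowers _ _
  have hpb : b ^ p ^ M ∈ Subgroup.zpowers (c ^ p) := by
    rw [h.b_pow, pow_mul]; exact Subgroup.npow_mem_zpowers _ _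
  have hzc : Subgroup.zpowers (c ^ p) ≤ Subgroup.zpowers c := by
    rw [Subgroup.zpowers_le]; exact Subgroup.npow_mem_zpowers _ _
  refine ⟨f, g, fa ▸ hmem _, gb ▸ hmem _, fa ▸ hord _, gb ▸ hord _, fb, ga, fc, gc, ?_,
    orderOf_eq_prime_pow (by simpa using hcp) h.c_pow, h.exists_conj hu.closure_eq, hpa, hpb⟩
  intro x hf hg
  obtain ⟨i, j, k, rfl⟩ := h.exists_zpow_mul_zpow hu.closure_eq x
  simp only [map_mul, map_zpow, fb, fc, ga, gc, one_zpow, mul_one, one_mul] at hf hg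
  rw [← orderOf_dvd_iff_zpow_eq_one, fa, hord] at hf
  rw [← orderOf_dvd_iff_zpow_eq_one, gb, hord] at hg
  obtain ⟨q, rfl⟩ := hf
  obtain ⟨r, rfl⟩ := hg
  refine Subgroup.mul_mem _ (Subgroup.mul_mem _ ?_ ?_) (Subgroup.zpow_mem_zpowers c k)
  · rw [zpow_mul, zpow_natCast]; exact Subgroup.zpow_mem _ (hzc hpa) q
  · rw [zpow_mul, zpow_natCast]; exact Subgroup.zpow_mem _ (hzc hpb) r

end UniformRelations

/-! ### Translation of the presentations into uniform relations. -/

namespace GroupLabel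

/-- The relations of type `L` hold for `a`, `b`, `c`. -/
def Satisfies (L : GroupLabel) (p n m t : ℕ) {G : Type*} [Group G] (a b c : G) : Prop :=
  ∀ q ∈ L.relations p n m t a b c, q.1 = q.2

theorem map_relations (L : GroupLabel) (p n m t : ℕ) {F K : Type*} [Group F] [Group K]
    (φ : F →* K) (a b c : F) : L.relations p n m t (φ a) (φ b) (φ c) =
      (L.relations p n m t a b c).map (Prod.map φ φ) := by
  cases L <;> simp [relations, comm]

theorem Satisfies.map {L : GroupLabel} {p n m t : ℕ} {F K : Type*} [Group F] [Group K]
    {a b c : F} (h : L.Satisfies p n m t a b c) (φ : F →* K) :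
    L.Satisfies p n m t (φ a) (φ b) (φ c) := by
  intro q hq
  rw [map_relations, List.mem_map] at hq
  obtain ⟨r, hr, rfl⟩ := hq
  exact congrArg φ (h r hr)

theorem exists_isUniversalTriple {L : GroupLabel} {p n m : ℕ} {t : (ZMod p)ˣ} {G : Type*} [Group G]
    (hG : Nonempty (G ≃* L.Model p n m t)) :
    ∃ a b c : G, L.Satisfies p n m (t : ZMod p).val a b c ∧
      IsUniversalTriple (fun x y z => L.Satisfies p n m (t : ZMod p).val x y z) a b c := by
  obtain ⟨e⟩ := hG
  set rels := L.relators p n m (t : ZMod p).val with hrels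
  have hmodel : L.Satisfies p n m (t : ZMod p).val (PresentedGroup.of (rels := rels) 0)
      (PresentedGroup.of (rels := rels) 1) (PresentedGroup.of (rels := rels) 2) := by
    intro q hq
    have hq' := map_relations L p n m (t : ZMod p).val (PresentedGroup.mk rels)
      (FreeGroup.of 0) (FreeGroup.of 1) (FreeGroup.of 2)
    change q ∈ L.relations p n m (t : ZMod p).val (PresentedGroup.mk rels (FreeGroup.of 0))
      (PresentedGroup.mk rels (FreeGroup.of 1)) (PresentedGroup.mk rels (FreeGroup.of 2)) at hq
    rw [hq', List.mem_map] at hq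
    obtain ⟨r, hr, rfl⟩ := hq
    have h1 : PresentedGroup.mk rels (r.1 * r.2⁻¹) = 1 :=
      PresentedGroup.one_of_mem ⟨r, hr, rfl⟩
    rw [map_mul, map_inv, mul_inv_eq_one] at h1
    exact h1
  refine ⟨e.symm (PresentedGroup.of 0), e.symm (PresentedGroup.of 1), e.symm (PresentedGroup.of 2),
    hmodel.map e.symm.toMonoidHom, ?_, ?_⟩
  · have h1 : ({e.symm (PresentedGroup.of 0), e.symm (PresentedGroup.of 1),
        e.symm (PresentedGroup.of 2)} : Set G) =
        e.symm.toMonoidHom '' Set.range (PresentedGroup.of (rels := rels)) := by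
      ext x
      simp only [Set.mem_insert_iff, Set.mem_singleton_iff, Set.mem_image, Set.mem_range,
        Fin.exists_fin_succ, eq_comm (a := x)]
      simp [eq_comm]
    rw [h1, ← MonoidHom.map_closure, PresentedGroup.closure_range_of, ← MonoidHom.range_eq_map,
      MonoidHom.range_eq_top]
    exact e.symm.surjective
  · intro Q _ x y z hxyz
    have hr : ∀ r ∈ rels, FreeGroup.lift ![x, y, z] r = 1 := by
      rintro _ ⟨q, hq, rfl⟩
      rw [map_mul, map_inv, mul_inv_eq_one]
      have hxyz' : L.Satisfies p n m (t : ZMod p).val (FreeGroup.lift ![x, y, z] (FreeGroup.of 0))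
          (FreeGroup.lift ![x, y, z] (FreeGroup.of 1))
          (FreeGroup.lift ![x, y, z] (FreeGroup.of 2)) := by
        simpa using hxyz
      rw [Satisfies, map_relations] at hxyz'
      exact hxyz' _ (List.mem_map.2 ⟨q, hq, rfl⟩)
    refine ⟨(PresentedGroup.toGroup hr).comp e.toMonoidHom, ?_, ?_, ?_⟩ <;> simp

end GroupLabel

namespace UniformRelations

variable {p N M α β ε δ : ℕ} {G : Type*} [Group G] {a b c : G}

theorem iff_zero_zero : UniformRelations p N M α β 0 0 a b c ↔
    a ^ p ^ N = 1 ∧ b ^ p ^ M = 1 ∧ c ^ p ^ 2 = 1 ∧ GroupLabel.comm a b = c ∧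
      GroupLabel.comm c a = c ^ (p * α) ∧ GroupLabel.comm c b = c ^ (p * β) := by
  constructor
  · rintro ⟨h1, h2, h3⟩
    simp_all
  · rintro ⟨h1, h2, h3, h4, h5, h6⟩
    constructor <;> simp_all

/-- Once `c ^ p = a ^ p ^ N`, the relations `a ^ p ^ (N + 1) = 1` and `c ^ p ^ 2 = 1` say the same.
-/
theorem iff_one_zero : UniformRelations p N M α β 1 0 a b c ↔
    a ^ p ^ (N + 1) = 1 ∧ b ^ p ^ M = 1 ∧ c ^ p = a ^ p ^ N ∧ GroupLabel.comm a b = c ∧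
      GroupLabel.comm c a = c ^ (p * α) ∧ GroupLabel.comm c b = c ^ (p * β) := by
  constructor
  · rintro ⟨h1, h2, h3, h4, h5, h6⟩
    rw [mul_one] at h1
    exact ⟨by rw [pow_succ, pow_mul, h1, ← pow_mul, ← sq, h3], by simpa using h2, h1.symm, h4, h5, h6⟩
  · rintro ⟨h1, h2, h3, h4, h5, h6⟩
    exact ⟨by rw [mul_one, h3], by simpa using h2, by rw [sq, pow_mul, h3, ← pow_mul, ← pow_succ, h1],
      h4, h5, h6⟩

theorem iff_zero_one : UniformRelations p N M α β 0 1 a b c ↔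
    a ^ p ^ N = 1 ∧ b ^ p ^ (M + 1) = 1 ∧ c ^ p = b ^ p ^ M ∧ GroupLabel.comm a b = c ∧
      GroupLabel.comm c a = c ^ (p * α) ∧ GroupLabel.comm c b = c ^ (p * β) := by
  constructor
  · rintro ⟨h1, h2, h3, h4, h5, h6⟩
    rw [mul_one] at h2
    exact ⟨by simpa using h1, by rw [pow_succ, pow_mul, h2, ← pow_mul, ← sq, h3], h2.symm, h4, h5, h6⟩
  · rintro ⟨h1, h2, h3, h4, h5, h6⟩
    exact ⟨by simpa using h1, by rw [mul_one, h3], by rw [sq, pow_mul, h3, ← pow_mul, ← pow_succ, h2],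
      h4, h5, h6⟩

theorem iff_one_one : UniformRelations p N M α β 1 1 a b c ↔
    a ^ p ^ (N + 1) = 1 ∧ c ^ p = a ^ p ^ N ∧ a ^ p ^ N = b ^ p ^ M ∧ GroupLabel.comm a b = c ∧
      GroupLabel.comm c a = c ^ (p * α) ∧ GroupLabel.comm c b = c ^ (p * β) := by
  constructor
  · rintro ⟨h1, h2, h3, h4, h5, h6⟩
    rw [mul_one] at h1 h2
    exact ⟨by rw [pow_succ, pow_mul, h1, ← pow_mul, ← sq, h3], h1.symm, h1.trans h2.symm, h4, h5, h6⟩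
  · rintro ⟨h1, h2, h3, h4, h5, h6⟩
    exact ⟨by rw [mul_one, h2], by rw [mul_one, h2, h3],
      by rw [sq, pow_mul, h2, ← pow_mul, ← pow_succ, h1], h4, h5, h6⟩

end UniformRelations

namespace GroupLabel

/-- The exponent `N` such that `a` has order `p ^ N` modulo `⟨c⟩`. -/
def expA (n m : ℕ) : GroupLabel → ℕ
  | A2 => m
  | _ => n

/-- The exponent `M` such that `b` has order `p ^ M` modulo `⟨c⟩`. -/
def expB (n m : ℕ) : GroupLabel → ℕ
  | A2 => n
  | _ => m

/-- The number `α` with `[c, a] = c ^ (p * α)`. -/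
def commA (t : ℕ) : GroupLabel → ℕ
  | A1 | A2 | A3 | C5 | D2 | D4 | E2 | E8 => 1
  | E5 => t
  | _ => 0

/-- The number `β` with `[c, b] = c ^ (p * β)`. -/
def commB (t : ℕ) : GroupLabel → ℕ
  | A1 | A2 | A3 | B1 | B2 | B3 | C3 | C4 | E4 | E7 => 1
  | D1 | E1 => t
  | _ => 0

/-- The number `ε` with `a ^ p ^ N = c ^ (p * ε)`. -/
def powA : GroupLabel → ℕ
  | A2 | A3 | B1 | C1 | C2 | C3 | C4 | C5 | D1 | D2 | D3 | E1 | E2 | E3 => 1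
  | _ => 0

/-- The number `δ` with `b ^ p ^ M = c ^ (p * δ)`. -/
def powB : GroupLabel → ℕ
  | B3 | C1 | C3 | E4 | E5 | E6 => 1
  | _ => 0

theorem satisfies_iff {L : GroupLabel} {p n m : ℕ} (hL : L.Admissible p n m) (t : ℕ)
    {G : Type*} [Group G] (a b c : G) : L.Satisfies p n m t a b c ↔
      UniformRelations p (L.expA n m) (L.expB n m) (L.commA t) (L.commB t) L.powA L.powB a b c := by
  cases L
  case' A1 | A2 | A3 | B1 | B2 | B3 | C1 | C2 | C3 | C4 | C5 => obtain ⟨rfl, hn, rfl⟩ := hL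
  case' A1 | A2 | A3 | C1 | C2 | C3 | C4 | C5 => subst hn
  case' D1 | D2 | D3 | D4 | D5 => obtain ⟨-, -, rfl⟩ := hL
  all_goals
    simp only [Satisfies, relations, expA, expB, commA, commB, powA, powB,
      UniformRelations.iff_zero_zero, UniformRelations.iff_one_zero, UniformRelations.iff_zero_one,
      UniformRelations.iff_one_one, List.forall_mem_cons, mul_zero, mul_one, pow_zero, pow_one,
      mul_comm t]
    norm_num

/-- For `N ≥ 2` both summands are divisible by `p ^ 2`; in the exceptional case the sum is `2 + 2 =
4`. -/
theorem sq_dvd_add_chooseTwo {p N α : ℕ} (h : 2 ≤ N ∨ p = 2 ∧ N = 1 ∧ α = 1) :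
    (p : ℤ) ^ 2 ∣ p ^ N + p * α * ((p : ℤ) ^ N).chooseTwo := by
  rcases h with h | ⟨rfl, rfl, rfl⟩
  · obtain ⟨k, rfl⟩ := Nat.exists_eq_add_of_le' h
    rw [show (p : ℤ) ^ (k + 2) = p * p ^ (k + 1) by ring, Int.chooseTwo_mul]
    exact ⟨p ^ k + α * (p ^ k * (p : ℤ).chooseTwo + p * ((p : ℤ) ^ (k + 1)).chooseTwo), by ring⟩
  · norm_num [Int.chooseTwo]

/-- The exponent is `1` only for `a` in type A2; on the `b` side this happens for A1, A3 and the
types B. In each case the matching commutator parameter is `1`. -/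
theorem commA_condition {L : GroupLabel} {p n m : ℕ} (hL : L.Admissible p n m) (t : ℕ) :
    2 ≤ L.expA n m ∨ p = 2 ∧ L.expA n m = 1 ∧ L.commA t = 1 := by
  cases L <;> simp only [Admissible] at hL <;> simp only [expA, commA, and_true] <;> omega

theorem commB_condition {L : GroupLabel} {p n m : ℕ} (hL : L.Admissible p n m) (t : ℕ) :
    2 ≤ L.expB n m ∨ p = 2 ∧ L.expB n m = 1 ∧ L.commB t = 1 := by
  cases L <;> simp only [Admissible] at hL <;> simp only [expB, commB, and_true] <;> omega

end GroupLabel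

/-! ### Conclusion for the individual types. -/

namespace IsBicyclicExtension

variable {p N M : ℕ} {G A B : Type*} [Group G] [Group A] [Group B]
  {a b c : G} {f : G →* A} {g : G →* B}

theorem commute_c_iff (h : IsBicyclicExtension p N M a b c f g) (hp : p.Prime) {x : G} {k : ℕ}
    (hx : GroupLabel.comm c x = c ^ (p * k)) : Commute c x ↔ p ∣ k := by
  rw [commute_iff_eq, GroupLabel.comm_eq_iff.1 hx, mul_eq_left, ← orderOf_dvd_iff_pow_eq_one,
    h.orderOf_c, sq, Nat.mul_dvd_mul_iff_left hp.pos]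

theorem commute_c (h : IsBicyclicExtension p N M a b c f g) (ha : Commute c a)
    (hb : Commute c b) (x : G) : Commute c x := by
  obtain ⟨i, j, k, -, -, rfl⟩ := h.exists_zpow x
  exact ((ha.zpow_right i).mul_right (hb.zpow_right j)).mul_right ((Commute.refl c).zpow_right k)

end IsBicyclicExtension

theorem theorem3p6 (p : ℕ) (hp : p.Prime) (n m : ℕ) (t : (ZMod p)ˣ) (L : GroupLabel)
    (hL : L.Admissible p n m) (G : Type*) [Group G] (hG : Nonempty (G ≃* L.Model p n m t)) :
    (L ∈ ({.A1, .A2, .A3, .C1, .C2, .C3, .C4, .C5, .D3, .D5, .E3, .E6, .E9} : Set GroupLabel) →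
      HasIMax p G 2) ∧
    (L ∈ ({.B1, .B2, .B3, .D1, .D2, .D4, .E1, .E4, .E7} : Set GroupLabel) →
      HasIMax p G n) ∧
    (L ∈ ({.E2, .E5, .E8} : Set GroupLabel) →
      HasIMax p G m) := by
  obtain ⟨a, b, c, hs, hu⟩ := GroupLabel.exists_isUniversalTriple hG
  have ht : ¬ p ∣ (t : ZMod p).val := by
    have : Fact p.Prime := ⟨hp⟩
    rw [← ZMod.natCast_eq_zero_iff, ZMod.natCast_val, ZMod.cast_id]
    exact t.ne_zero
  have hA := GroupLabel.commA_condition hL (t : ZMod p).val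
  have hB := GroupLabel.commB_condition hL (t : ZMod p).val
  have hr := (GroupLabel.satisfies_iff hL _ a b c).1 hs
  obtain ⟨f, g, h⟩ := hr.exists_isBicyclicExtension hp
    ⟨hu.closure_eq, fun x y z hxyz => hu.exists_hom x y z
      ((GroupLabel.satisfies_iff hL _ x y z).2 hxyz)⟩
    (by omega) (by omega) (GroupLabel.sq_dvd_add_chooseTwo hA) (GroupLabel.sq_dvd_add_chooseTwo hB)
  have hca := h.commute_c_iff hp hr.comm_ca
  have hcb := h.commute_c_iff hp hr.comm_cb
  have key_b : ¬ p ∣ L.commB (t : ZMod p).val → 2 ≤ L.expA n m →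
      (p ∣ L.commA (t : ZMod p).val ∨ L.expB n m ≤ L.expA n m) → HasIMax p G (L.expA n m) :=
    fun h1 h2 h3 => h.hasIMax_of_not_commute hp (mt hcb.1 h1) h2 (h3.imp_left hca.2)
  have key_a : ¬ p ∣ L.commA (t : ZMod p).val → 2 ≤ L.expB n m →
      (p ∣ L.commB (t : ZMod p).val ∨ L.expA n m ≤ L.expB n m) → HasIMax p G (L.expB n m) :=
    fun h1 h2 h3 => h.symm.hasIMax_of_not_commute hp (mt hca.1 h1) h2 (h3.imp_left hcb.2)
  have key_c : p ∣ L.commA (t : ZMod p).val → p ∣ L.commB (t : ZMod p).val → HasIMax p G 2 :=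
    fun h1 h2 => h.hasIMax_two_of_commute hp (by omega) (h.commute_c (hca.2 h1) (hcb.2 h2))
      (GroupLabel.comm_eq_iff.1 hr.comm_ab)
  have h1 := hp.not_dvd_one
  clear hu hs hr hA hB hca hcb h hG
  cases L <;>
    simp only [GroupLabel.expA, GroupLabel.expB, GroupLabel.commA, GroupLabel.commB, dvd_zero,
      ht, h1, not_true_eq_false, not_false_eq_true, forall_const, true_or, false_or,
      false_imp_iff] at key_a key_b key_c <;>
    simp only [Set.mem_insert_iff, Set.mem_singleton_iff, reduceCtorEq, or_self, or_true,
      false_imp_iff, true_imp_iff, and_true, true_and, or_false]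
  case' A1 | A2 | A3 | C1 | C2 | C3 | C4 | C5 => obtain ⟨-, rfl, rfl⟩ := hL
  case' B1 | B2 | B3 => obtain ⟨-, hn, -⟩ := hL
  case' D1 | D2 | D3 | D4 | D5 => obtain ⟨hn, -, rfl⟩ := hL
  case' E1 | E2 | E3 | E4 | E5 | E6 | E7 | E8 | E9 => obtain ⟨hm, hn⟩ := hL
  -- `key_c` serves the types with `c` central. Types A and C3–C5 have noncentral `c`, and their
  -- value `2` is instead the exponent `N` or `M` given by `key_b` or `key_a`.
  all_goals first
    | exact key_c
    | exact key_b (by omega)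
    | exact key_a (by omega)
    | exact key_b (by omega) (by omega)
    | exact key_a (by omega) (by omega)
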